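/- Partitions are written as nonincreasing sequences of positive integers, $m_a(\pi)$ denotes the multiplicity of $a$ in $\pi$, $\ell(\pi)$ the number of parts of $\pi$, and a part is repeated if it appears at least twice. Let $\langle a^m\rangle$ be the partition consisting of $m$ copies of $a$, and let $\cup$ be the union of partitions with multiplicities. Let $A_3(n)$ be the number of partitions of $n$ with the following property: if $2j-1$ is the largest repeated odd part (where $j:=0$ if no odd part is repeated), then every positive odd integer less than $2j$ appears exactly twice and no part greater than $2j$ is repeated. Let $\mathcal A_3$ be the set of all partitions with this property. Let $C_{3,3}(n)$ be the number of partitions of $n$ into parts $\not\equiv 0,\pm 3 \pmod 7$. Let $\mathcal G_3$ be the set of all partitions $\pi$ with $m_1(\pi)\le 2$ and $m_j(\pi)+m_{j+1}(\pi)\le 2$ for all $j\ge 1$ (the partitions of $n$ in $\mathcal G_3$ are those counted by Gordon's $G_{3,3}(n)$). For a partition $\pi$ let $D(\pi)$ be the number of distinct repeated parts, let $R_1(\pi)>R_2(\pi)>\dots>R_{D(\pi)}(\pi)$ be the repeated parts, and put $R_{D(\pi)+1}(\pi)=0$. Let $\pi^{(0)}$ be the partition formed by the parts of $\pi$ greater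 than $R_1(\pi)$, and, for $1\le i\le D(\pi)$, let $\pi^{(i)}$ be the one formed by the parts of $\pi$ strictly between $R_{i+1}(\pi)$ and $R_i(\pi)$. Define three maps: * $g(\pi)$, for $\pi\in\mathcal G_3$, is obtained from $\pi$ by adding $1$ to each part; * $f(\pi)$, for $\pi\in g(\mathcal G_3)$, is $$f(\pi)=\bigcup_{i=1}^{D(\pi)}\left\langle (2i)^{R_i(\pi)-R_{i+1}(\pi)-\ell(\pi^{(i)})}\right\rangle\ \cup\ \bigcup_{i=0}^{D(\pi)}\left(\pi^{(i)}+2i\right),$$ where $\pi^{(i)}+2i$ is $\pi^{(i)}$ with $2i$ added to each of its parts; * $h(\lambda)$, for $\lambda\in f(g(\mathcal G_3))$, is obtained from $\lambda$ by subtracting $1$ from each part greater than $R_1(\lambda)$ and subtracting $1$ from two $2$'s, two $4$'s, $\dots$, two $R_1(\lambda)$'s (here $R_1(\lambda)$ is even). **Theorem.** For every integer $n\ge 0$, $$A_3(n)=C_{3,3}(n),$$ and $h\circ f\circ g$ maps the set of partitions of $n$ in $\mathcal G_3$ bijectively onto the set of partitions of $n$ in $\mathcal A_3$. -/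

import Mathlib

/-! A partition is represented by the multiset of its (positive) parts; `s.count j` is the
multiplicity of `j` in `s`, `s.card` is the length, and `+` on multisets is the union of
partitions. -/

namespace RogersSelberg

/-- `C k i n`: the number of partitions of `n` into parts not congruent to `0`, `i` or `-i`
modulo `2 * k + 1`. -/
noncomputable def C (k i n : ℕ) : ℕ :=
  Nat.card {p : n.Partition // ∀ a ∈ p.parts,
    ¬ (a : ℤ) ≡ 0 [ZMOD (2 * k + 1)] ∧ ¬ (a : ℤ) ≡ i [ZMOD (2 * k + 1)] ∧
      ¬ (a : ℤ) ≡ -i [ZMOD (2 * k + 1)]}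

/-- The condition on the partitions counted by `A₃`. The first alternative is the case in which
no odd part is repeated (the case `j = 0`): then no part greater than `0` is repeated. -/
def IsA3 (s : Multiset ℕ) : Prop :=
  s.Nodup ∨
    ∃ j : ℕ, 1 ≤ j ∧ IsGreatest {a : ℕ | Odd a ∧ 2 ≤ s.count a} (2 * j - 1) ∧
      (∀ a : ℕ, Odd a → a < 2 * j → s.count a = 2) ∧
      (∀ a : ℕ, 2 * j < a → s.count a ≤ 1)

/-- `A₃(n)`. -/
noncomputable def A3 (n : ℕ) : ℕ := Nat.card {p : n.Partition // IsA3 p.parts}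

/-- Gordon's condition: `1` appears at most `i - 1` times, and any two consecutive
positive integers appear in total at most `k - 1` times (for `1 ≤ i ≤ k`). -/
def IsGordon (k i : ℕ) (s : Multiset ℕ) : Prop :=
  s.count 1 < i ∧ ∀ j : ℕ, 1 ≤ j → s.count j + s.count (j + 1) < k

/-- The set of those integers that are repeated in `s`. -/
def repeated (s : Multiset ℕ) : Finset ℕ := s.toFinset.filter fun a => 2 ≤ s.count a

/-- The number `D(s)` of different repeated parts. -/
def D (s : Multiset ℕ) : ℕ := (repeated s).card

/-- `R s k` is the `k`-th largest repeated part, for `1 ≤ k ≤ D s`, and `R s (D s + 1) = 0`.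
The value at `k = 0` is not used. -/
def R (s : Multiset ℕ) : ℕ → ℕ
  | 0 => 0
  | 1 => (repeated s).sup id
  | k + 2 => ((repeated s).filter fun a => a < R s (k + 1)).sup id

/-- The subpartition of the parts greater than the largest repeated part
(all parts, if none is repeated). -/
def P (s : Multiset ℕ) : Multiset ℕ := s.filter fun a => R s 1 < a

/-- `block s 0` is the subpartition of the parts greater than `R s 1`; for `k ≥ 1`, `block s k` is
the subpartition of the parts strictly between `R s (k + 1)` and `R s k`. -/
def block (s : Multiset ℕ) : ℕ → Multiset ℕ
  | 0 => P s
  | k + 1 => s.filter fun a => R s (k + 2) < a ∧ a < R s (k + 1)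

/-- The map `g`: add `1` to every part. -/
def g (s : Multiset ℕ) : Multiset ℕ := s.map fun a => a + 1

/-- The map `f`: the union of `R s i - R s (i + 1) - ℓ(block s i)` copies of `2 * i`
for `1 ≤ i ≤ D s` and of the partitions `block s i` with `2 * i` added to each of
their parts, `0 ≤ i ≤ D s`. -/
def f (s : Multiset ℕ) : Multiset ℕ :=
  (∑ i ∈ Finset.Icc 1 (D s),
      Multiset.replicate (R s i - R s (i + 1) - (block s i).card) (2 * i)) +
    ∑ i ∈ Finset.range (D s + 1), (block s i).map fun a => a + 2 * i

/-- The partition `2, 2, 4, 4, …, 2 * m, 2 * m`. -/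
def evenPairs (m : ℕ) : Multiset ℕ := ∑ i ∈ Finset.Icc 1 m, Multiset.replicate 2 (2 * i)

/-- The map `h`: subtract `1` from each part of `P s`, and subtract `1` from two `2`s, two `4`s,
…, two `R s 1`s. All other parts stay. -/
def h (s : Multiset ℕ) : Multiset ℕ :=
  ((P s).map fun a => a - 1) + ((evenPairs (R s 1 / 2)).map fun a => a - 1) +
    (s - P s - evenPairs (R s 1 / 2))

end RogersSelberg

/-! The bijection reduces the count to Gordon's theorem for k = i = 3, which is proved separately in
`ncard_gordonSet`.

Gordon's theorem. Take the admissible partitions with all parts greater than s and fewer than i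
parts equal to s + 1. Sorting by the multiplicity of s + 1 gives G(i+1, s) = G(i, s) + q^((s+1)i)
G(3-i, s+1) for i ≤ 2 (`gordonSeries_succ`). The Rogers–Selberg series at x = q^s, multiplied by
(q)_∞, obeys the same recurrence (`rsSum_succ`). Both it and (q)_∞ G vanish at i = 0, and for i ≥ 1
both agree with (1-q)⋯(1-q^s) modulo q^(s+1). Hence they coincide (`coeff_eq_zero_of_recurrence`).
At i = 3, s = 0 the series is a theta series, which the triple product evaluates as ∏
(1-q^(7n+3))(1-q^(7n+4))(1-q^(7n+7)) (`prod_congr_rsSum`). Except for Euler's product, everything is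
finite and modulo a power of X.

Bijection. In a partition from g(𝒢₃) a repeated part occurs exactly twice and its neighbours are
absent. Such a partition arises from one without repeated parts by successively inserting a new
largest repeated pair r, r and raising the parts at least r by 2 (`Good.exists_ins`). One insertion
changes f simply: raise all parts of f by 2 and adjoin m copies of 2 (`f_ins`). For fixed t, the
admissible r correspond bijectively to the numbers m ≥ 2 (`Valid.unique`, `Good.exists_valid`). Thus
f is injective, with image described by `IsImageF`. On that image h is inverted directly from its
multiplicities (`IsImageF.count_h`). Sizes match because f preserves the sum, while g adds and h
removes one unit per part of the original partition. -/

namespace RogersSelberg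

/-! ### Gaussian binomials and the finite q-binomial theorem. -/

section GaussianBinomial

variable {R : Type*} [CommRing R]

/-- The Gaussian binomial coefficient `[a + b; a]` at `q`. -/
def gauss (q : R) : ℕ → ℕ → R
  | 0, _ => 1
  | _ + 1, 0 => 1
  | a + 1, b + 1 => gauss q a (b + 1) + q ^ (a + 1) * gauss q (a + 1) b

theorem gauss_zero_left (q : R) (b : ℕ) : gauss q 0 b = 1 := by rw [gauss]

theorem gauss_zero_right (q : R) (a : ℕ) : gauss q a 0 = 1 := by cases a <;> rw [gauss]

theorem gauss_succ_succ (q : R) (a b : ℕ) :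
    gauss q (a + 1) (b + 1) = gauss q a (b + 1) + q ^ (a + 1) * gauss q (a + 1) b := by
  rw [gauss]

/-- The finite product `(1 - q) (1 - q ^ 2) ⋯ (1 - q ^ n)`. -/
def qFactorial (q : R) (n : ℕ) : R := ∏ j ∈ Finset.range n, (1 - q ^ (j + 1))

theorem qFactorial_succ (q : R) (n : ℕ) :
    qFactorial q (n + 1) = qFactorial q n * (1 - q ^ (n + 1)) := Finset.prod_range_succ _ _

theorem gauss_mul_qFactorial (q : R) (a b : ℕ) :
    gauss q a b * qFactorial q a * qFactorial q b = qFactorial q (a + b) := by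
  induction a generalizing b with
  | zero => simp [gauss_zero_left, qFactorial]
  | succ a iha =>
    induction b with
    | zero => simp [gauss_zero_right, qFactorial]
    | succ b ihb =>
      have h1 := iha (b + 1)
      rw [gauss_succ_succ, show a + 1 + (b + 1) = (a + b + 1) + 1 by ring, qFactorial_succ q
        (a + b + 1)]
      rw [show a + 1 + b = a + b + 1 by ring, qFactorial_succ] at ihb
      rw [show a + (b + 1) = a + b + 1 by ring, qFactorial_succ] at h1
      rw [qFactorial_succ, qFactorial_succ]
      linear_combination (1 - q ^ (a + 1)) * h1 + q ^ (a + 1) * (1 - q ^ (b + 1)) * ihb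

theorem choose_succ_two (k : ℕ) : (k + 1).choose 2 = k + k.choose 2 := by
  rw [Nat.choose_succ_succ' k 1, Nat.choose_one_right]

/-- The finite `q`-binomial theorem. -/
theorem prod_add_mul_pow (q x y : R) (M : ℕ) :
    ∏ j ∈ Finset.range M, (y + x * q ^ j) =
      ∑ p ∈ Finset.HasAntidiagonal.antidiagonal M, q ^ p.1.choose 2 * gauss q p.1 p.2 * x ^ p.1 * y ^ p.2 := by
  induction M generalizing x with
  | zero => simp [gauss_zero_left]
  | succ M ih =>
    have key : ∏ j ∈ Finset.range (M + 1), (y + x * q ^ j) =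
        (y + x) * ∏ j ∈ Finset.range M, (y + (x * q) * q ^ j) := by
      rw [Finset.prod_range_succ', mul_comm]
      congr 1
      · simp
      · exact Finset.prod_congr rfl fun j _ => by ring
    rw [key, ih, add_mul, Finset.mul_sum, Finset.mul_sum]
    -- Pascal's rule needs both lower indices positive, so the two extreme terms of the antidiagonal
    -- are split off; this requires a successor.
    cases M with
    | zero => simp [Finset.Nat.antidiagonal_succ, gauss_zero_left, gauss_zero_right]
    | succ M =>
      rw [Finset.Nat.antidiagonal_succ_succ', Finset.sum_cons, Finset.sum_cons, Finset.sum_map,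
        Finset.Nat.antidiagonal_succ, Finset.sum_cons, Finset.sum_map,
        ← Finset.Nat.antidiagonal_succ, Finset.Nat.antidiagonal_succ', Finset.sum_cons,
        Finset.sum_map]
      simp only [gauss_zero_left, gauss_zero_right, Function.Embedding.coe_prodMap, Prod.map,
        Function.Embedding.coeFn_mk, Function.Embedding.refl_apply, gauss_succ_succ, mul_add,
        add_mul, Finset.sum_add_distrib, choose_succ_two]
      have h1 : ∀ p : ℕ × ℕ, y * (q ^ (p.1 + p.1.choose 2) * gauss q (p.1 + 1) p.2 *
          (x * q) ^ (p.1 + 1) * y ^ p.2) = q ^ (p.1 + p.1.choose 2) * (q ^ (p.1 + 1) *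
          gauss q (p.1 + 1) p.2) * x ^ (p.1 + 1) * y ^ (p.2 + 1) := fun p => by ring
      have h2 : ∀ p : ℕ × ℕ, x * (q ^ p.1.choose 2 * gauss q p.1 (p.2 + 1) *
          (x * q) ^ p.1 * y ^ (p.2 + 1)) = q ^ (p.1 + p.1.choose 2) *
          gauss q p.1 (p.2 + 1) * x ^ (p.1 + 1) * y ^ (p.2 + 1) := fun p => by ring
      simp only [Nat.succ_eq_add_one, h1, h2]
      simp only [Nat.choose_zero_succ]
      ring_nf

end GaussianBinomial

open PowerSeries

/-! ### Congruences for q-factorials and Gaussian binomials. -/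

theorem X_pow_dvd_qFactorial_sub (m k n : ℕ) (h : k ≤ n) :
    (X : ℤ⟦X⟧) ^ (m * (k + 1)) ∣ qFactorial (X ^ m) n - qFactorial (X ^ m) k := by
  induction n, h using Nat.le_induction with
  | base => simp
  | succ n hn ih =>
    rw [qFactorial_succ]
    have h1 : (X : ℤ⟦X⟧) ^ (m * (k + 1)) ∣ (X ^ m) ^ (n + 1) := by
      rw [← pow_mul]
      exact pow_dvd_pow _ (Nat.mul_le_mul_left _ (by omega))
    have := dvd_sub ih (h1.mul_left (qFactorial (X ^ m) n))
    convert this using 1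
    ring

theorem isUnit_qFactorial (m n : ℕ) (hm : m ≠ 0) : IsUnit (qFactorial ((X : ℤ⟦X⟧) ^ m) n) := by
  rw [PowerSeries.isUnit_iff_constantCoeff]
  simp [qFactorial, map_prod, hm]

/-- With k = min(a, b), all q-factorials in `gauss_mul_qFactorial` agree with the k-th one, u,
modulo the given power. So g u u ≡ u, and the unit u cancels. -/
theorem X_pow_dvd_qFactorial_mul_gauss_sub_one (m a b N k : ℕ) (hm : m ≠ 0) (ha : k ≤ a)
    (hb : k ≤ b) (hN : k ≤ N) (hk : k = a ∨ k = b) :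
    (X : ℤ⟦X⟧) ^ (m * (k + 1)) ∣ qFactorial (X ^ m) N * gauss (X ^ m) a b - 1 := by
  have hu := isUnit_qFactorial m k hm
  obtain ⟨c1, h1⟩ := X_pow_dvd_qFactorial_sub m k a ha
  obtain ⟨c2, h2⟩ := X_pow_dvd_qFactorial_sub m k b hb
  obtain ⟨c3, h3⟩ := X_pow_dvd_qFactorial_sub m k N hN
  obtain ⟨c4, h4⟩ := X_pow_dvd_qFactorial_sub m k (a + b) (by omega)
  have hg := gauss_mul_qFactorial ((X : ℤ⟦X⟧) ^ m) a b
  rw [← (hu.pow 1).dvd_mul_left]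
  set u := qFactorial ((X : ℤ⟦X⟧) ^ m) k
  set g := gauss ((X : ℤ⟦X⟧) ^ m) a b
  rw [sub_eq_iff_eq_add] at h1 h2 h3 h4
  have : (X : ℤ⟦X⟧) ^ (m * (k + 1)) ∣ u * (g * u - 1) := by
    rcases hk with rfl | rfl
    · refine ⟨c4 - g * u * c2, ?_⟩
      rw [h4, h2] at hg
      linear_combination hg
    · refine ⟨c4 - g * u * c1, ?_⟩
      rw [h4, h1] at hg
      linear_combination hg
  obtain ⟨c, hc⟩ := this
  rw [h3]
  refine ⟨c + u * c3 * g, ?_⟩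
  linear_combination hc

/-! ### The Rogers–Selberg series, multiplied by (q)_∞, and its recurrence. -/

/-- The `n`-th term of the Rogers–Selberg series with parameter `i`, evaluated at `x = q ^ s`. -/
noncomputable def rsTerm (i s n : ℕ) : ℤ⟦X⟧ :=
  (-1) ^ n * X ^ (3 * s * n + 7 * n.choose 2 + (7 - i) * n) * (1 - X ^ (i * (s + 2 * n + 1))) *
    ∏ j ∈ Finset.range s, (1 - X ^ (n + 1 + j))

/-- The truncated Rogers–Selberg series. -/
noncomputable def rsSum (M i s : ℕ) : ℤ⟦X⟧ := ∑ n ∈ Finset.range M, rsTerm i s n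

theorem rsSum_zero (M s : ℕ) : rsSum M 0 s = 0 := by simp [rsSum, rsTerm]

/-- Auxiliary term by which the recurrence of the Rogers–Selberg series telescopes. -/
noncomputable def rsAux (i s n : ℕ) : ℤ⟦X⟧ :=
  (-1) ^ n * X ^ (3 * s * n + 7 * n.choose 2 + (6 - i) * n) *
    ∏ j ∈ Finset.range (s + 1), (1 - X ^ (n + j))

theorem rsTerm_succ_sub (i s n : ℕ) (hi : i ≤ 2) :
    rsTerm (i + 1) s n - rsTerm i s n =
      X ^ ((s + 1) * i) * rsTerm (3 - i) (s + 1) n + (rsAux i s n - rsAux i s (n + 1)) := by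
  have e1 : ∏ j ∈ Finset.range (s + 1), ((1 : ℤ⟦X⟧) - X ^ (n + j)) =
      (∏ j ∈ Finset.range s, (1 - X ^ (n + 1 + j))) * (1 - X ^ n) := by
    rw [Finset.prod_range_succ']
    simp only [add_zero]
    congr 1
    exact Finset.prod_congr rfl fun j _ => by rw [show n + (j + 1) = n + 1 + j by ring]
  have e2 : ∏ j ∈ Finset.range (s + 1), ((1 : ℤ⟦X⟧) - X ^ (n + 1 + j)) =
      (∏ j ∈ Finset.range s, (1 - X ^ (n + 1 + j))) * (1 - X ^ (n + 1 + s)) :=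
    Finset.prod_range_succ _ _
  unfold rsTerm rsAux
  rw [e1, e2, choose_succ_two]
  -- All terms share this product and the binomial exponent. For numerical i the truncated
  -- differences evaluate and a ring identity remains.
  generalize (∏ j ∈ Finset.range s, ((1 : ℤ⟦X⟧) - X ^ (n + 1 + j))) = P
  generalize n.choose 2 = c
  interval_cases i <;> norm_num <;> ring

theorem rsAux_zero (i s : ℕ) : rsAux i s 0 = 0 := by
  simp [rsAux, Finset.prod_range_succ']

theorem X_pow_dvd_rsAux (i s n : ℕ) (hi : i ≤ 2) : (X : ℤ⟦X⟧) ^ n ∣ rsAux i s n := by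
  have : (X : ℤ⟦X⟧) ^ n ∣ X ^ (3 * s * n + 7 * n.choose 2 + (6 - i) * n) := by
    apply pow_dvd_pow
    have : 1 * n ≤ (6 - i) * n := Nat.mul_le_mul_right _ (by omega)
    omega
  exact (this.mul_left _).mul_right _

/-- The auxiliary terms telescope: the one at 0 contains the factor 1 - X^0, and the one at M is the
truncation error. -/
theorem rsSum_succ (M i s : ℕ) (hi : i ≤ 2) :
    (X : ℤ⟦X⟧) ^ M ∣
      rsSum M (i + 1) s - (rsSum M i s + X ^ ((s + 1) * i) * rsSum M (3 - i) (s + 1)) := by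
  have h := Finset.sum_congr (rfl : Finset.range M = _) fun n _ => rsTerm_succ_sub i s n hi
  rw [Finset.sum_sub_distrib, Finset.sum_add_distrib, Finset.sum_range_sub', rsAux_zero,
    ← Finset.mul_sum] at h
  have := X_pow_dvd_rsAux i s M hi
  rw [← dvd_neg] at this
  convert this using 1
  unfold rsSum
  linear_combination h

/-- Terms of positive index have order greater than s, and the initial term is the q-factorial times
1 - X^(i(s+1)). This is the boundary condition as s grows. -/
theorem X_pow_dvd_rsSum_sub (M i s : ℕ) (hM : M ≠ 0) (hi0 : i ≠ 0) (hi : i ≤ 3) :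
    (X : ℤ⟦X⟧) ^ (s + 1) ∣ rsSum M i s - qFactorial X s := by
  obtain ⟨M, rfl⟩ := Nat.exists_eq_succ_of_ne_zero hM
  unfold rsSum
  rw [Finset.sum_range_succ', add_sub_assoc]
  refine dvd_add (Finset.dvd_sum fun n _ => ?_) ?_
  · unfold rsTerm
    refine Dvd.dvd.mul_right (Dvd.dvd.mul_right (Dvd.dvd.mul_left (pow_dvd_pow _ ?_) _) _) _
    have h1 : 1 * (n + 1) ≤ (7 - i) * (n + 1) := Nat.mul_le_mul_right _ (by omega)
    nlinarith
  · have : rsTerm i s 0 - qFactorial X s = - X ^ (i * (s + 1)) * qFactorial X s := by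
      simp only [rsTerm, qFactorial]
      simp [add_comm]
      ring
    rw [this]
    refine Dvd.dvd.mul_right ((dvd_neg.mpr (pow_dvd_pow _ ?_))) _
    exact Nat.le_mul_of_pos_left _ (by omega)

/-- A solution of the Rogers–Selberg recurrence that vanishes in the limit is zero. -/
theorem coeff_eq_zero_of_recurrence (M : ℕ) (d : ℕ → ℕ → ℤ⟦X⟧) (h0 : ∀ s, d 0 s = 0)
    (hlim : ∀ i s, i ≤ 3 → (X : ℤ⟦X⟧) ^ (s + 1) ∣ d i s)
    (hrec : ∀ i s, i ≤ 2 →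
      (X : ℤ⟦X⟧) ^ M ∣ d (i + 1) s - (d i s + X ^ ((s + 1) * i) * d (3 - i) (s + 1)))
    (i s : ℕ) (hi : i ≤ 3) : (X : ℤ⟦X⟧) ^ M ∣ d i s := by
  -- The recurrence raises s, so the induction descends from s ≥ M, where the limit condition
  -- suffices; for each s an inner induction climbs in i.
  suffices H : ∀ k s, M ≤ s + k → ∀ i ≤ 3, (X : ℤ⟦X⟧) ^ M ∣ d i s from
    H M s (by omega) i hi
  intro k
  induction k with
  | zero => exact fun s hs i hi => (pow_dvd_pow _ (by omega)).trans (hlim i s hi)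
  | succ k ih =>
    intro s hs i
    induction i with
    | zero => simp [h0]
    | succ i ihi =>
      intro hi
      have h1 := dvd_add (ihi (by omega))
        ((ih (s + 1) (by omega) (3 - i) (by omega)).mul_left (X ^ ((s + 1) * i)))
      simpa using dvd_add (hrec i s (by omega)) h1

/-! ### A finite triple product with base X^7. -/

theorem rsTerm_three_zero (n : ℕ) : rsTerm 3 0 n =
    (-1) ^ n * X ^ (7 * n.choose 2 + 4 * n) + (-1) ^ (n + 1) * X ^ (7 * n.choose 2 + 10 * n + 3) := by
  simp only [rsTerm, Finset.range_zero, Finset.prod_empty]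
  norm_num
  ring

theorem two_mul_choose_two (a : ℕ) : 2 * (a.choose 2 : ℤ) = a * (a - 1) := by
  induction a with
  | zero => simp
  | succ a ih => rw [choose_succ_two]; push_cast; linarith

theorem X_pow_congr {a b : ℕ} (h : (a : ℤ) = b) : (X : ℤ⟦X⟧) ^ a = X ^ b := by
  rw [Nat.cast_injective h]

theorem neg_one_pow_congr' {a b c : ℕ} (h : a + 2 * c = b) :
    (-1 : ℤ⟦X⟧) ^ a = (-1) ^ b := by
  rw [← h, pow_add, pow_mul]; simp

/-- Folding about the centre pairs the theta indices n and -n-1, which are the two monomials of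
`rsTerm_three_zero`; the term F 0 has no partner. -/
theorem sum_range_two_mul_add_one {A : Type*} [AddCommMonoid A] (F : ℕ → A) (N : ℕ) :
    ∑ k ∈ Finset.range (2 * N + 1), F k =
      F 0 + ∑ n ∈ Finset.range N, (F (N - n) + F (N + n + 1)) := by
  rw [show 2 * N + 1 = N + N + 1 by ring, Finset.sum_range_succ', Finset.sum_range_add,
    Finset.sum_add_distrib, add_comm]
  congr 2
  rw [← Finset.sum_range_reflect]
  exact Finset.sum_congr rfl fun n hn => by
    rw [Finset.mem_range] at hn
    rw [show N - 1 - n + 1 = N - n by omega]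

/-- The product side of the triple product at finite level. -/
theorem prod_eq_mul_prod (N : ℕ) :
    ∏ j ∈ Finset.range (2 * N), ((X : ℤ⟦X⟧) ^ (7 * N) + (-X ^ 3) * (X ^ 7) ^ j) =
      (-1) ^ N * X ^ (7 * N.choose 2 + 3 * N + 7 * N * N) *
        ∏ i ∈ Finset.range N, ((1 - X ^ (7 * i + 3)) * (1 - X ^ (7 * i + 4))) := by
  rw [two_mul, Finset.prod_range_add, Finset.prod_mul_distrib, ← Finset.prod_range_reflect]
  have h1 : ∀ j ∈ Finset.range N, (X : ℤ⟦X⟧) ^ (7 * N) + (-X ^ 3) * (X ^ 7) ^ (N - 1 - j) =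
      - X ^ 3 * (X ^ 7) ^ (N - 1 - j) * (1 - X ^ (7 * j + 4)) := by
    intro j hj
    rw [Finset.mem_range] at hj
    obtain ⟨c, rfl⟩ : ∃ c, N = j + 1 + c := ⟨N - (j + 1), by omega⟩
    rw [show j + 1 + c - 1 - j = c by omega]
    ring
  have h2 : ∀ j ∈ Finset.range N, (X : ℤ⟦X⟧) ^ (7 * N) + (-X ^ 3) * (X ^ 7) ^ (N + j) =
      X ^ (7 * N) * (1 - X ^ (7 * j + 3)) := fun j _ => by ring
  rw [Finset.prod_congr rfl h1, Finset.prod_congr rfl h2, Finset.prod_mul_distrib,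
    Finset.prod_mul_distrib, Finset.prod_mul_distrib,
    Finset.prod_range_reflect (fun j => ((X : ℤ⟦X⟧) ^ 7) ^ j), Finset.prod_pow_eq_pow_sum,
    Finset.sum_range_id, ← Nat.choose_two_right, Finset.prod_const, Finset.prod_const,
    Finset.card_range, neg_pow]
  ring

/-- The `k`-th term of the expansion of the product by the finite `q`-binomial theorem. -/
noncomputable def jtpTerm (a b N : ℕ) : ℤ⟦X⟧ :=
  (X ^ 7) ^ a.choose 2 * gauss (X ^ 7) a b * (-X ^ 3) ^ a * (X ^ (7 * N)) ^ b

theorem jtpTerm_lower (N n : ℕ) (hn : n ≤ N) : jtpTerm (N - n) (2 * N - (N - n)) N =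
    (-1) ^ N * X ^ (7 * N.choose 2 + 3 * N + 7 * N * N) *
      ((-1) ^ n * X ^ (7 * n.choose 2 + 4 * n) * gauss (X ^ 7) (N - n) (N + n)) := by
  obtain ⟨m, rfl⟩ := Nat.exists_eq_add_of_le hn
  rw [show n + m - n = m by omega, show 2 * (n + m) - m = n + m + n by omega]
  have h1 : (X : ℤ⟦X⟧) ^ (7 * m.choose 2 + 3 * m + 7 * (n + m) * (n + m + n)) =
      X ^ ((7 * (n + m).choose 2 + 3 * (n + m) + 7 * (n + m) * (n + m)) +
        (7 * n.choose 2 + 4 * n)) := by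
    apply X_pow_congr
    have := two_mul_choose_two m
    have := two_mul_choose_two n
    have := two_mul_choose_two (n + m)
    push_cast at *
    linarith
  have h2 : (-1 : ℤ⟦X⟧) ^ m = (-1) ^ (n + m + n) := neg_one_pow_congr' (c := n) (by ring)
  calc _ = (-1) ^ m * (X : ℤ⟦X⟧) ^ (7 * m.choose 2 + 3 * m + 7 * (n + m) * (n + m + n)) *
        gauss (X ^ 7) m (n + m + n) := by unfold jtpTerm; rw [neg_pow]; ring
    _ = _ := by rw [h1, h2]; ring

theorem jtpTerm_upper (N n : ℕ) (hn : n < N) : jtpTerm (N + n + 1) (2 * N - (N + n + 1)) N =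
    (-1) ^ N * X ^ (7 * N.choose 2 + 3 * N + 7 * N * N) *
      ((-1) ^ (n + 1) * X ^ (7 * n.choose 2 + 10 * n + 3) *
        gauss (X ^ 7) (N + n + 1) (N - (n + 1))) := by
  obtain ⟨m, rfl⟩ := Nat.exists_eq_add_of_le (Nat.succ_le_of_lt hn)
  rw [show n.succ + m - (n + 1) = m by omega,
    show 2 * (n.succ + m) - (n.succ + m + n + 1) = m by omega, Nat.succ_eq_add_one]
  have h1 : (X : ℤ⟦X⟧) ^ (7 * (n + 1 + m + n + 1).choose 2 + 3 * (n + 1 + m + n + 1) +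
      7 * (n + 1 + m) * m) =
      X ^ ((7 * (n + 1 + m).choose 2 + 3 * (n + 1 + m) + 7 * (n + 1 + m) * (n + 1 + m)) +
        (7 * n.choose 2 + 10 * n + 3)) := by
    apply X_pow_congr
    have := two_mul_choose_two (n + 1 + m + n + 1)
    have := two_mul_choose_two n
    have := two_mul_choose_two (n + 1 + m)
    push_cast at *
    linarith
  calc _ = (-1) ^ (n + 1 + m + n + 1) * (X : ℤ⟦X⟧) ^ (7 * (n + 1 + m + n + 1).choose 2 +
        3 * (n + 1 + m + n + 1) + 7 * (n + 1 + m) * m) *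
        gauss (X ^ 7) (n + 1 + m + n + 1) m := by unfold jtpTerm; rw [neg_pow]; ring
    _ = _ := by rw [h1]; ring

/-- A finite form of the triple product, with base `X ^ 7` at `X ^ 3`. -/
theorem prod_eq_sum_gauss (N : ℕ) :
    ∏ i ∈ Finset.range N, (((1 : ℤ⟦X⟧) - X ^ (7 * i + 3)) * (1 - X ^ (7 * i + 4))) =
      (-1) ^ N * X ^ (7 * N.choose 2 + 4 * N) * gauss (X ^ 7) 0 (2 * N) +
      ∑ n ∈ Finset.range N,
        ((-1) ^ n * X ^ (7 * n.choose 2 + 4 * n) * gauss (X ^ 7) (N - n) (N + n) +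
          (-1) ^ (n + 1) * X ^ (7 * n.choose 2 + 10 * n + 3) *
            gauss (X ^ 7) (N + n + 1) (N - (n + 1))) := by
  have hc : ((-1 : ℤ⟦X⟧) ^ N * X ^ (7 * N.choose 2 + 3 * N + 7 * N * N)) ≠ 0 :=
    mul_ne_zero (pow_ne_zero _ (by simp)) (pow_ne_zero _ X_ne_zero)
  apply mul_left_cancel₀ hc
  -- The q-binomial theorem is used with x = -X^3, y = X^(7N) and 2N factors. Taking y = X^(7N)
  -- instead of 1 avoids negative exponents, at the price of the monomial just cancelled.
  rw [← prod_eq_mul_prod, prod_add_mul_pow, Finset.Nat.sum_antidiagonal_eq_sum_range_succ_mk]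
  have := sum_range_two_mul_add_one (fun k => jtpTerm k (2 * N - k) N) N
  unfold jtpTerm at this
  rw [Nat.succ_eq_add_one, this]
  have h0 := jtpTerm_lower N N le_rfl
  have e : ∀ n ∈ Finset.range N, jtpTerm (N - n) (2 * N - (N - n)) N +
      jtpTerm (N + n + 1) (2 * N - (N + n + 1)) N = _ := fun n hn => by
    rw [jtpTerm_lower N n (Finset.mem_range.1 hn).le, jtpTerm_upper N n (Finset.mem_range.1 hn),
      ← mul_add]
  rw [Nat.sub_self] at h0
  unfold jtpTerm at h0 e
  rw [h0, Finset.sum_congr rfl e, ← Finset.mul_sum, ← mul_add, two_mul]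

theorem prod_congr_rsSum (N : ℕ) :
    (X : ℤ⟦X⟧) ^ N ∣ ∏ i ∈ Finset.range N, ((1 - X ^ (7 * i + 3)) * (1 - X ^ (7 * i + 4)) *
      (1 - X ^ (7 * i + 7))) - rsSum N 3 0 := by
  have hq : ∏ i ∈ Finset.range N, ((1 : ℤ⟦X⟧) - X ^ (7 * i + 7)) = qFactorial (X ^ 7) N :=
    Finset.prod_congr rfl fun i _ => by ring
  rw [Finset.prod_mul_distrib, hq, prod_eq_sum_gauss, add_mul, add_sub_assoc, Finset.sum_mul,
    rsSum, ← Finset.sum_sub_distrib]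
  refine dvd_add ?_ (Finset.dvd_sum fun n hn => ?_)
  · exact (Dvd.dvd.mul_left (pow_dvd_pow _ (by omega)) _ |>.mul_right _ |>.mul_right _)
  · rw [Finset.mem_range] at hn
    rw [rsTerm_three_zero]
    -- After multiplication by the q-factorial each Gaussian coefficient is 1 up to an error of
    -- order about 7(N - n); the monomial in front raises this order to at least N.
    obtain ⟨c1, h1⟩ := X_pow_dvd_qFactorial_mul_gauss_sub_one 7 (N - n) (N + n) N (N - n)
      (by omega) le_rfl (by omega) (by omega) (Or.inl rfl)
    obtain ⟨c2, h2⟩ := X_pow_dvd_qFactorial_mul_gauss_sub_one 7 (N + n + 1) (N - (n + 1)) N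
      (N - (n + 1)) (by omega) (by omega) le_rfl (by omega) (Or.inr rfl)
    have : ((-1) ^ n * X ^ (7 * n.choose 2 + 4 * n) * gauss (X ^ 7) (N - n) (N + n) +
          (-1) ^ (n + 1) * X ^ (7 * n.choose 2 + 10 * n + 3) *
            gauss (X ^ 7) (N + n + 1) (N - (n + 1))) * qFactorial ((X : ℤ⟦X⟧) ^ 7) N -
        ((-1) ^ n * X ^ (7 * n.choose 2 + 4 * n) +
          (-1) ^ (n + 1) * X ^ (7 * n.choose 2 + 10 * n + 3)) =
        (-1) ^ n * c1 * (X ^ (7 * n.choose 2 + 4 * n) * X ^ (7 * (N - n + 1))) +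
        (-1) ^ (n + 1) * c2 *
          (X ^ (7 * n.choose 2 + 10 * n + 3) * X ^ (7 * (N - (n + 1) + 1))) := by
      linear_combination (-1) ^ n * X ^ (7 * n.choose 2 + 4 * n) * h1 +
        (-1) ^ (n + 1) * X ^ (7 * n.choose 2 + 10 * n + 3) * h2
    rw [this, ← pow_add, ← pow_add]
    exact dvd_add (Dvd.dvd.mul_left (pow_dvd_pow _ (by omega)) _)
      (Dvd.dvd.mul_left (pow_dvd_pow _ (by omega)) _)

/-! ### Gordon's partitions and their recurrence. -/

/-- The multisets of integers greater than `s` of sum `n` in which `s + 1` appears fewer than `i`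
times and any two consecutive positive integers appear fewer than three times in total. -/
def gordonSet (i s n : ℕ) : Set (Multiset ℕ) :=
  {m | m.sum = n ∧ (∀ a ∈ m, s < a) ∧ m.count (s + 1) < i ∧
    ∀ j, 1 ≤ j → m.count j + m.count (j + 1) < 3}

theorem exists_partition_iff (n : ℕ) (m : Multiset ℕ) :
    (∃ p : n.Partition, p.parts = m) ↔ m.sum = n ∧ ∀ a ∈ m, 0 < a := by
  constructor
  · rintro ⟨p, rfl⟩
    exact ⟨p.parts_sum, fun a ha => p.parts_pos ha⟩
  · rintro ⟨h1, h2⟩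
    exact ⟨⟨m, fun {a} ha => h2 a ha, h1⟩, rfl⟩

theorem finite_gordonSet (i s n : ℕ) : (gordonSet i s n).Finite := by
  refine (Set.finite_range (Nat.Partition.parts (n := n))).subset ?_
  rintro m ⟨h1, h2, -⟩
  exact (exists_partition_iff n m).2 ⟨h1, fun a ha => (Nat.zero_le s).trans_lt (h2 a ha)⟩

theorem gordonSet_zero (s n : ℕ) : gordonSet 0 s n = ∅ := by
  ext m; simp [gordonSet]

theorem sum_filter_lt_add_replicate (m : Multiset ℕ) (s : ℕ) (h : ∀ a ∈ m, s < a) :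
    m = m.filter (fun a => s + 1 < a) + Multiset.replicate (m.count (s + 1)) (s + 1) := by
  ext a
  rw [Multiset.count_add, Multiset.count_filter, Multiset.count_replicate]
  rcases lt_trichotomy a (s + 1) with h1 | h1 | h1
  · have : a ∉ m := fun ha => by have := h a ha; omega
    rw [Multiset.count_eq_zero_of_notMem this]
    split_ifs <;> omega
  · subst h1; simp
  · simp [h1, h1.ne]

theorem gordonSet_succ (i s n : ℕ) :
    gordonSet (i + 1) s n = gordonSet i s n ∪
      {m | m ∈ gordonSet (i + 1) s n ∧ m.count (s + 1) = i} := by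
  ext m
  simp only [gordonSet, Set.mem_union, Set.mem_ofPred_eq]
  constructor
  · rintro ⟨h1, h2, h3, h4⟩
    rcases Nat.lt_succ_iff_lt_or_eq.1 h3 with h | h
    · exact Or.inl ⟨h1, h2, h, h4⟩
    · exact Or.inr ⟨⟨h1, h2, h3, h4⟩, h⟩
  · rintro (⟨h1, h2, h3, h4⟩ | ⟨h, -⟩)
    · exact ⟨h1, h2, by omega, h4⟩
    · exact h

/-- Once the i copies of s + 1 are removed, the bound on consecutive parts says exactly that s + 2
occurs fewer than 3 - i times. -/
theorem gordonSet_count_eq (i s n : ℕ) (hi : i ≤ 2) (hn : (s + 1) * i ≤ n) :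
    {m | m ∈ gordonSet (i + 1) s n ∧ m.count (s + 1) = i} =
      (· + Multiset.replicate i (s + 1)) '' gordonSet (3 - i) (s + 1) (n - (s + 1) * i) := by
  ext m
  simp only [gordonSet, Set.mem_image, Set.mem_ofPred_eq]
  constructor
  · rintro ⟨⟨h1, h2, h3, h4⟩, rfl⟩
    have hm := sum_filter_lt_add_replicate m s h2
    refine ⟨m.filter (fun a => s + 1 < a), ⟨?_, ?_, ?_, ?_⟩, hm.symm⟩
    · have := congrArg Multiset.sum hm
      rw [Multiset.sum_add, Multiset.sum_replicate, smul_eq_mul, mul_comm] at this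
      omega
    · intro a ha
      exact (Multiset.mem_filter.1 ha).2
    · have := h4 (s + 1) (by omega)
      rw [Multiset.count_filter]
      split_ifs <;> omega
    · intro j hj
      have := h4 j hj
      have h5 := Multiset.count_le_of_le j (Multiset.filter_le (fun a => s + 1 < a) m)
      have h6 := Multiset.count_le_of_le (j + 1) (Multiset.filter_le (fun a => s + 1 < a) m)
      omega
  · rintro ⟨t, ⟨h1, h2, h3, h4⟩, rfl⟩
    have h0 : ∀ a, a ≤ s + 1 → t.count a = 0 := fun a ha =>
      Multiset.count_eq_zero_of_notMem fun h => by have := h2 a h; omega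
    refine ⟨⟨?_, ?_, ?_, ?_⟩, ?_⟩
    · rw [Multiset.sum_add, Multiset.sum_replicate, smul_eq_mul, mul_comm]; omega
    · intro a ha
      rcases Multiset.mem_add.1 ha with h | h
      · have := h2 a h; omega
      · rw [Multiset.eq_of_mem_replicate h]; omega
    · simp [h0]
    · intro j hj
      have := h4 j hj
      have h01 := h0 j
      have h02 := h0 (j + 1)
      simp only [Multiset.count_add, Multiset.count_replicate]
      split_ifs with h5 h6 h6
      · omega
      · subst h5; omega
      · have := h01 (by omega); have := h02 (by omega); omega
      · omega
    · simp [h0]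

/-- The generating function of the cardinalities of `gordonSet i s n`. -/
noncomputable def gordonSeries (i s : ℕ) : ℤ⟦X⟧ := PowerSeries.mk fun n => ((gordonSet i s n).ncard : ℤ)

theorem gordonSeries_zero (s : ℕ) : gordonSeries 0 s = 0 := by
  ext n; simp [gordonSeries, gordonSet_zero]

theorem gordonSeries_succ (i s : ℕ) (hi : i ≤ 2) : gordonSeries (i + 1) s =
    gordonSeries i s + X ^ ((s + 1) * i) * gordonSeries (3 - i) (s + 1) := by
  ext n
  rw [map_add, coeff_X_pow_mul']
  simp only [gordonSeries, coeff_mk]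
  rw [gordonSet_succ i s n, Set.ncard_union_eq _ (finite_gordonSet i s n)
    ((finite_gordonSet (i + 1) s n).subset fun m hm => hm.1)]
  · push_cast
    congr 1
    split_ifs with h
    · rw [gordonSet_count_eq i s n hi h, Set.ncard_image_of_injective _ (add_left_injective _)]
    · norm_cast
      rw [Set.ncard_eq_zero ((finite_gordonSet (i + 1) s n).subset fun m hm => hm.1)]
      refine Set.eq_empty_of_forall_notMem fun m hm => h ?_
      obtain ⟨⟨h1, h2, -⟩, rfl⟩ := hm
      have := congrArg Multiset.sum (sum_filter_lt_add_replicate m s h2)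
      rw [Multiset.sum_add, Multiset.sum_replicate, smul_eq_mul, mul_comm] at this
      omega
  · rw [Set.disjoint_left]
    rintro m ⟨-, -, h1, -⟩ ⟨-, h2⟩
    omega

theorem X_pow_dvd_gordonSeries_sub_one (i s : ℕ) (hi : i ≠ 0) :
    (X : ℤ⟦X⟧) ^ (s + 1) ∣ gordonSeries i s - 1 := by
  rw [X_pow_dvd_iff]
  intro n hn
  rw [map_sub, coeff_one, gordonSeries, coeff_mk]
  split_ifs with h
  · subst h
    have : gordonSet i s 0 = {0} := by
      ext m
      simp only [gordonSet, Set.mem_ofPred_eq, Set.mem_singleton_iff]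
      constructor
      · rintro ⟨h1, h2, -⟩
        refine Multiset.eq_zero_of_forall_notMem fun a ha => ?_
        have := h2 a ha
        have := Multiset.le_sum_of_mem ha
        omega
      · rintro rfl
        simp; omega
    simp [this]
  · have : gordonSet i s n = ∅ := by
      refine Set.eq_empty_of_forall_notMem ?_
      rintro m ⟨h1, h2, -⟩
      rcases Multiset.empty_or_exists_mem m with rfl | ⟨a, ha⟩
      · exact h (by simpa using h1.symm)
      · have := h2 a ha
        have := Multiset.le_sum_of_mem ha
        omega
    simp [this]

/-! ### Euler's product and Gordon's theorem for k = i = 3. -/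

open scoped PowerSeries.WithPiTopology in
-- E is Euler's infinite product; multiplying by it cancels the geometric series of the allowed part
-- sizes. The conclusions speak only of coefficients and divisibility, so the topology stays inside
-- this proof.
theorem exists_eulerSeries (p : ℕ → Prop) [DecidablePred p] :
    ∃ E : ℤ⟦X⟧, E ≠ 0 ∧ (∀ s, X ^ (s + 1) ∣ E - qFactorial X s) ∧
      ∀ n, ∃ N₀, ∀ N ≥ N₀,
        coeff n (PowerSeries.mk (fun n => ((Nat.Partition.restricted n p).card : ℤ)) * E) =
          coeff n (∏ i ∈ Finset.range N, if p (i + 1) then (1 : ℤ⟦X⟧) else 1 - X ^ (i + 1)) := by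
  let _ : TopologicalSpace ℤ := ⊥
  have _ : DiscreteTopology ℤ := ⟨rfl⟩
  have hE := WithPiTopology.multipliable_one_sub_X_pow ℤ
  -- With ℤ discrete, convergence means that each coefficient is eventually constant.
  have hev : ∀ {f : ℕ → ℤ⟦X⟧} {g : ℤ⟦X⟧}, HasProd f g → ∀ n, ∃ N₀, ∀ N ≥ N₀,
      coeff n g = coeff n (∏ i ∈ Finset.range N, f i) := by
    intro f g hfg n
    have h := (WithPiTopology.tendsto_iff_coeff_tendsto _ _ _ _).1 hfg.tendsto_prod_nat n
    rw [nhds_discrete, Filter.tendsto_pure, Filter.eventually_atTop] at h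
    obtain ⟨N₀, h⟩ := h
    exact ⟨N₀, fun N hN => (h N hN).symm⟩
  refine ⟨∏' i, (1 - X ^ (i + 1)), WithPiTopology.tprod_one_sub_X_pow_ne_zero ℤ, fun s => ?_, ?_⟩
  · rw [X_pow_dvd_iff]
    intro n hn
    obtain ⟨N₀, h⟩ := hev hE.hasProd n
    rw [map_sub, h (max N₀ s) (le_max_left _ _), ← map_sub]
    have := X_pow_dvd_qFactorial_sub 1 s (max N₀ s) (le_max_right _ _)
    rw [one_mul, pow_one] at this
    exact (X_pow_dvd_iff.1 this) n hn
  · refine hev ?_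
    have hfun : (fun i => if p (i + 1) then (1 : ℤ⟦X⟧) else 1 - X ^ (i + 1)) = fun i =>
        (if p (i + 1) then ∑' j : ℕ, X ^ ((i + 1) * j) else 1) * (1 - X ^ (i + 1)) := by
      funext i
      split_ifs
      · simp_rw [pow_mul]
        rw [WithPiTopology.tsum_pow_mul_one_sub_of_constantCoeff_eq_zero (by simp)]
      · rw [one_mul]
    rw [hfun]
    exact (Nat.Partition.hasProd_powerSeriesMk_card_restricted ℤ p).mul hE.hasProd

theorem prod_range_mod_seven (N : ℕ) :
    ∏ i ∈ Finset.range (7 * N), (if (i + 1) % 7 ≠ 0 ∧ (i + 1) % 7 ≠ 3 ∧ (i + 1) % 7 ≠ 4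
      then (1 : ℤ⟦X⟧) else 1 - X ^ (i + 1)) =
    ∏ i ∈ Finset.range N, ((1 - X ^ (7 * i + 3)) * (1 - X ^ (7 * i + 4)) *
      (1 - X ^ (7 * i + 7))) := by
  induction N with
  | zero => simp
  | succ N ih =>
    rw [show 7 * (N + 1) = 7 * N + 1 + 1 + 1 + 1 + 1 + 1 + 1 by ring]
    iterate 7 rw [Finset.prod_range_succ]
    rw [ih, Finset.prod_range_succ]
    rw [if_pos (by omega), if_pos (by omega), if_neg (by omega), if_neg (by omega),
      if_pos (by omega), if_pos (by omega), if_neg (by omega)]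
    ring

theorem ncard_gordonSet_eq_card_restricted (n : ℕ) : (gordonSet 3 0 n).ncard =
    (Nat.Partition.restricted n fun a => a % 7 ≠ 0 ∧ a % 7 ≠ 3 ∧ a % 7 ≠ 4).card := by
  obtain ⟨E, hE0, hE, hC⟩ := exists_eulerSeries fun a => a % 7 ≠ 0 ∧ a % 7 ≠ 3 ∧ a % 7 ≠ 4
  have key : gordonSeries 3 0 = PowerSeries.mk fun n => ((Nat.Partition.restricted n
      fun a => a % 7 ≠ 0 ∧ a % 7 ≠ 3 ∧ a % 7 ≠ 4).card : ℤ) := by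
    refine mul_right_cancel₀ hE0 ?_
    ext n
    obtain ⟨N₀, hN₀⟩ := hC n
    obtain ⟨N, hN1, hN2⟩ : ∃ N, N₀ ≤ N ∧ n < N := ⟨N₀ + n + 1, by omega, by omega⟩
    rw [hN₀ (7 * N) (by omega), prod_range_mod_seven]
    have h1 := prod_congr_rsSum N
    -- The difference satisfies the homogeneous recurrence modulo X^N and vanishes in the limit,
    -- since both terms approach the same q-factorial.
    have h2 := coeff_eq_zero_of_recurrence N (fun i s => rsSum N i s - gordonSeries i s * E)
      (fun s => by simp [rsSum_zero, gordonSeries_zero])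
      (fun i s hi => by
        rcases eq_or_ne i 0 with rfl | hi0
        · simp [rsSum_zero, gordonSeries_zero]
        · have := dvd_sub (dvd_sub (X_pow_dvd_rsSum_sub N i s (by omega) hi0 hi) (hE s))
            ((X_pow_dvd_gordonSeries_sub_one i s hi0).mul_right E)
          convert this using 1
          ring)
      (fun i s hi => by
        convert rsSum_succ N i s hi using 1
        rw [gordonSeries_succ i s hi]
        ring) 3 0 le_rfl
    have h3 := X_pow_dvd_iff.1 (dvd_add h1 h2) n hN2
    rw [sub_add_sub_cancel, map_sub, sub_eq_zero] at h3
    exact h3.symm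
  have := congrArg (coeff n) key
  simp only [gordonSeries, coeff_mk] at this
  exact_mod_cast this

theorem C_three_three (n : ℕ) : C 3 3 n =
    (Nat.Partition.restricted n fun a => a % 7 ≠ 0 ∧ a % 7 ≠ 3 ∧ a % 7 ≠ 4).card := by
  rw [C, Nat.Partition.restricted, ← Nat.subtype_card]
  intro p
  simp only [Finset.mem_filter, Finset.mem_univ, true_and]
  refine forall₂_congr fun a _ => ?_
  simp only [Int.ModEq]
  omega

/-- Gordon's theorem for `k = i = 3`. -/
theorem ncard_gordonSet (n : ℕ) : (gordonSet 3 0 n).ncard = C 3 3 n := by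
  rw [C_three_three, ncard_gordonSet_eq_card_restricted]

/-! ### Multiplicities under translation, and repeated parts. -/

theorem count_map_add (s : Multiset ℕ) (c a : ℕ) :
    (s.map fun x => x + c).count a = if c ≤ a then s.count (a - c) else 0 := by
  split_ifs with h
  · obtain ⟨b, rfl⟩ := Nat.exists_eq_add_of_le' h
    rw [Nat.add_sub_cancel]
    exact Multiset.count_map_eq_count' _ _ (add_left_injective c) b
  · refine Multiset.count_eq_zero_of_notMem fun ha => ?_
    obtain ⟨b, -, rfl⟩ := Multiset.mem_map.1 ha
    omega

theorem count_map_sub (s : Multiset ℕ) (c : ℕ) (hs : ∀ x ∈ s, c ≤ x) (a : ℕ) :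
    (s.map fun x => x - c).count a = s.count (a + c) := by
  have h : (s.map fun x => x - c).map (fun x => x + c) = s := by
    rw [Multiset.map_map]
    conv_rhs => rw [← Multiset.map_id s]
    exact Multiset.map_congr rfl fun x hx => Nat.sub_add_cancel (hs x hx)
  conv_rhs => rw [← h]
  rw [count_map_add, if_pos (by omega), Nat.add_sub_cancel]

theorem mem_repeated {s : Multiset ℕ} {a : ℕ} : a ∈ repeated s ↔ 2 ≤ s.count a := by
  rw [repeated, Finset.mem_filter, Multiset.mem_toFinset, ← Multiset.one_le_count_iff_mem]
  omega

theorem le_R_one {s : Multiset ℕ} {a : ℕ} (h : 2 ≤ s.count a) : a ≤ R s 1 :=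
  Finset.le_sup (f := id) (mem_repeated.2 h)

theorem count_le_one {s : Multiset ℕ} {a : ℕ} (h : R s 1 < a) : s.count a ≤ 1 := by
  by_contra! h1
  exact absurd (le_R_one h1) (by omega)

theorem R_add_two (s : Multiset ℕ) (k : ℕ) :
    R s (k + 2) = ((repeated s).filter fun a => a < R s (k + 1)).sup id := rfl

theorem R_succ_le_R_one (s : Multiset ℕ) (k : ℕ) : R s (k + 1) ≤ R s 1 := by
  cases k with
  | zero => exact le_rfl
  | succ k => exact Finset.sup_mono (Finset.filter_subset _ _)

theorem two_le_count_R_one {s : Multiset ℕ} (h : 0 < D s) : 2 ≤ s.count (R s 1) := by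
  obtain ⟨a, ha, h⟩ := Finset.exists_mem_eq_sup (repeated s) (Finset.card_pos.1 h) id
  rw [R, h]
  exact mem_repeated.1 ha

theorem D_eq_zero_iff {s : Multiset ℕ} : D s = 0 ↔ ∀ a, s.count a ≤ 1 := by
  rw [D, Finset.card_eq_zero, Finset.eq_empty_iff_forall_notMem]
  simp only [mem_repeated]
  exact forall_congr' fun a => by omega

theorem R_one_of_D_eq_zero {s : Multiset ℕ} (h : D s = 0) : R s 1 = 0 := by
  rw [D, Finset.card_eq_zero] at h
  rw [R, h, Finset.sup_empty, bot_eq_zero]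

/-! ### Insertion of a new largest repeated part. -/

/-- The multisets obtained by adding `1` to the parts of the partitions in `𝒢₃`. -/
structure Good (s : Multiset ℕ) : Prop where
  two_le : ∀ a ∈ s, 2 ≤ a
  count_le : ∀ a, s.count a + s.count (a + 1) ≤ 2

theorem Good.count_eq_zero {s : Multiset ℕ} (h : Good s) {a : ℕ} (ha : a < 2) : s.count a = 0 :=
  Multiset.count_eq_zero_of_notMem fun h' => by have := h.two_le a h'; omega

theorem Good.count_R_one_add_one {s : Multiset ℕ} (h : Good s) : s.count (R s 1 + 1) = 0 := by
  rcases Nat.eq_zero_or_pos (D s) with h0 | h0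
  · rw [R_one_of_D_eq_zero h0]; exact h.count_eq_zero (by omega)
  · have := h.count_le (R s 1)
    have := two_le_count_R_one h0
    omega

/-- Insert two parts `r` into `t`, and add `2` to all parts that are at least `r`. -/
def ins (t : Multiset ℕ) (r : ℕ) : Multiset ℕ :=
  t.filter (fun a => a < r) + Multiset.replicate 2 r +
    (t.filter fun a => r ≤ a).map fun a => a + 2

theorem count_ins (t : Multiset ℕ) (r a : ℕ) : (ins t r).count a =
    if a < r then t.count a else if a = r then 2 else if a < r + 2 then 0 else
      t.count (a - 2) := by
  rw [ins, Multiset.count_add, Multiset.count_add, count_map_add]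
  simp only [Multiset.count_filter, Multiset.count_replicate]
  split_ifs <;> omega

/-- `r` may be inserted into `t` as a new largest repeated part. -/
structure Valid (t : Multiset ℕ) (r : ℕ) : Prop where
  two_le : 2 ≤ r
  lt : R t 1 < r
  count_pred : t.count (r - 1) = 0

/-- A repeated part R t 1 cannot equal r - 1, which is absent from t; without repeated parts R t 1 =
0 and r ≥ 2. -/
theorem Valid.add_two_le {t : Multiset ℕ} {r : ℕ} (h : Valid t r) : R t 1 + 2 ≤ r := by
  have h1 := h.two_le
  have h2 := h.lt
  have h3 := h.count_pred
  rcases Nat.eq_zero_or_pos (D t) with h0 | h0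
  · rw [R_one_of_D_eq_zero h0]; omega
  · have := two_le_count_R_one h0
    by_contra! h4
    rw [show r - 1 = R t 1 by omega] at h3
    omega

theorem repeated_ins {t : Multiset ℕ} {r : ℕ} (h : Valid t r) :
    repeated (ins t r) = insert r (repeated t) := by
  ext a
  rw [Finset.mem_insert, mem_repeated, mem_repeated, count_ins]
  have h1 := h.lt
  constructor
  · intro ha
    split_ifs at ha with h2 h3 h4
    · exact Or.inr ha
    · exact Or.inl h3
    · omega
    · have := le_R_one ha; omega
  · rintro (rfl | ha)
    · simp
    · have := le_R_one ha
      rwa [if_pos (by omega)]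

theorem D_ins {t : Multiset ℕ} {r : ℕ} (h : Valid t r) : D (ins t r) = D t + 1 := by
  rw [D, repeated_ins h, Finset.card_insert_of_notMem, D]
  intro h1
  have := le_R_one (mem_repeated.1 h1)
  have := h.lt
  omega

theorem R_ins_one {t : Multiset ℕ} {r : ℕ} (h : Valid t r) : R (ins t r) 1 = r := by
  rw [R, repeated_ins h, Finset.sup_insert]
  exact sup_eq_left.2 h.lt.le

theorem R_ins_succ {t : Multiset ℕ} {r : ℕ} (h : Valid t r) (k : ℕ) :
    R (ins t r) (k + 2) = R t (k + 1) := by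
  induction k with
  | zero =>
    rw [zero_add, zero_add, R_add_two _ 0, zero_add, R_ins_one h, repeated_ins h,
      Finset.filter_insert, if_neg (lt_irrefl r), R]
    congr 1
    refine Finset.filter_true_of_mem fun a ha => ?_
    exact (le_R_one (mem_repeated.1 ha)).trans_lt h.lt
  | succ k ih =>
    have := R_succ_le_R_one t k
    have := h.lt
    rw [R_add_two, ih, repeated_ins h, Finset.filter_insert, if_neg (by omega), R_add_two]

theorem R_ins_two {t : Multiset ℕ} {r : ℕ} (h : Valid t r) : R (ins t r) 2 = R t 1 :=
  R_ins_succ h 0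

theorem P_ins {t : Multiset ℕ} {r : ℕ} (h : Valid t r) :
    P (ins t r) = (t.filter fun a => r ≤ a).map fun a => a + 2 := by
  ext a
  rw [P, R_ins_one h, count_map_add]
  simp only [Multiset.count_filter, count_ins]
  split_ifs <;> omega

theorem block_ins_one {t : Multiset ℕ} {r : ℕ} (h : Valid t r) :
    block (ins t r) 1 = (P t).filter fun a => a < r := by
  ext a
  simp only [block, P, zero_add, R_ins_one h, R_ins_two h, Multiset.count_filter, count_ins]
  split_ifs <;> omega

theorem block_ins_succ {t : Multiset ℕ} {r : ℕ} (h : Valid t r) (k : ℕ) :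
    block (ins t r) (k + 2) = block t (k + 1) := by
  ext a
  have := R_succ_le_R_one t k
  have := h.lt
  simp only [block, R_ins_succ h, Multiset.count_filter, count_ins]
  split_ifs <;> omega

/-- The number of parts of `t` strictly between the largest repeated part and `r`. -/
def between (t : Multiset ℕ) (r : ℕ) : ℕ := ((P t).filter fun a => a < r).card

theorem f_eq_sum_range (s : Multiset ℕ) : f s =
    (∑ i ∈ Finset.range (D s), Multiset.replicate
      (R s (i + 1) - R s (i + 2) - (block s (i + 1)).card) (2 * (i + 1))) +
    ∑ i ∈ Finset.range (D s + 1), (block s i).map fun a => a + 2 * i := by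
  rw [f]
  congr 1
  rw [Finset.range_eq_Ico, Finset.sum_Ico_add' (fun i => Multiset.replicate
      (R s i - R s (i + 1) - (block s i).card) (2 * i)) 0 (D s) 1]
  rfl

/-- Insertion shifts the indices of the old repeated parts and of the blocks below them by one,
hence the translation by 2. The top block splits at r: its lower portion becomes block 1, translated
by f, and its upper portion was already raised by `ins`. -/
theorem f_ins {t : Multiset ℕ} {r : ℕ} (h : Valid t r) : f (ins t r) =
    Multiset.replicate (r - R t 1 - between t r) 2 + (f t).map fun a => a + 2 := by
  rw [f_eq_sum_range, f_eq_sum_range, D_ins h, Finset.sum_range_succ' _ (D t),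
    Finset.sum_range_succ' _ (D t + 1), Finset.sum_range_succ' _ (D t),
    Finset.sum_range_succ' _ (D t)]
  simp only [zero_add, R_ins_one h, R_ins_two h, R_ins_succ h, block_ins_one h, block_ins_succ h,
    Multiset.map_add, mul_one, mul_zero, add_zero, Multiset.map_id']
  have h1 : ((P t).filter fun a => a < r).map (fun a => a + 2) + P (ins t r) =
      (P t).map fun a => a + 2 := by
    conv_rhs => rw [← Multiset.filter_add_not (fun a => a < r) (P t)]
    rw [Multiset.map_add, P_ins h]
    congr 2
    rw [P, Multiset.filter_filter]
    have := h.lt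
    exact Multiset.filter_congr fun a _ => by omega
  have h2 : ∀ F : ℕ → Multiset ℕ, (∑ i ∈ Finset.range (D t), F i).map (fun a => a + 2) =
      ∑ i ∈ Finset.range (D t), (F i).map (fun a => a + 2) := fun F =>
    map_sum (Multiset.mapAddMonoidHom fun a => a + 2) F _
  rw [h2, h2]
  simp only [Multiset.map_replicate, Multiset.map_map, Function.comp_def]
  have h3 : block (ins t r) 0 = P (ins t r) := rfl
  have h4 : block t 0 = P t := rfl
  rw [h3, h4, ← h1]
  simp only [mul_add, add_assoc, mul_one, between]
  ac_rfl

theorem Good.ins {t : Multiset ℕ} {r : ℕ} (ht : Good t) (h : Valid t r) : Good (ins t r) := by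
  have h2 := h.two_le
  constructor
  · intro a ha
    by_contra! h1
    have := Multiset.one_le_count_iff_mem.2 ha
    have := ht.count_eq_zero h1
    rw [count_ins] at *
    split_ifs at * <;> omega
  · intro a
    have h3 := h.count_pred
    have h4 := ht.count_le a
    have h5 := ht.count_le (a - 2)
    have h6 := ht.count_le r
    rw [count_ins, count_ins]
    have h7 : a + 1 = r → t.count a = 0 := by rintro rfl; exact h3
    have h8 : a = r + 1 → t.count (a + 1 - 2) ≤ 2 := by rintro rfl; simp; omega
    have h9 : 2 ≤ a → t.count (a + 1 - 2) = t.count (a - 2 + 1) := fun h9 => by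
      rw [show a + 1 - 2 = a - 2 + 1 by omega]
    split_ifs <;> omega

/-- Undo the insertion: delete both copies of the largest repeated part r and lower the larger parts
by 2. As r + 1 is absent, these stay at least r. -/
theorem Good.exists_ins {s : Multiset ℕ} (hs : Good s) (h : 0 < D s) :
    ∃ t r, Good t ∧ Valid t r ∧ s = RogersSelberg.ins t r := by
  set r := R s 1 with hr
  have hr2 := two_le_count_R_one h
  rw [← hr] at hr2
  have h2r : 2 ≤ r := hs.two_le r (Multiset.one_le_count_iff_mem.1 (by omega))
  have hsucc : s.count (r + 1) = 0 := hs.count_R_one_add_one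
  have hpred : s.count (r - 1) = 0 := by
    have := hs.count_le (r - 1)
    rw [show r - 1 + 1 = r by omega] at this
    omega
  have hrr := hs.count_le r
  have hgt : ∀ a, r < a → s.count a ≤ 1 := fun a ha => count_le_one ha
  let t : Multiset ℕ := s.filter (fun a => a < r) +
    (s.filter fun a => r + 1 < a).map fun a => a - 2
  have ht : ∀ a, t.count a = if a < r then s.count a else s.count (a + 2) := by
    intro a
    have : ∀ x ∈ s.filter fun a => r + 1 < a, 2 ≤ x := fun x hx => by
      have := (Multiset.mem_filter.1 hx).2; omega
    rw [Multiset.count_add, count_map_sub _ _ this]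
    simp only [Multiset.count_filter]
    split_ifs <;> omega
  have hR : R t 1 < r := by
    refine (Finset.sup_lt_iff (by rw [bot_eq_zero]; omega)).2 fun a ha => ?_
    rw [mem_repeated, ht] at ha
    by_contra! h1
    have h1 : r ≤ a := h1
    rw [if_neg (by omega)] at ha
    have := hgt (a + 2) (by omega)
    omega
  refine ⟨t, r, ⟨?_, ?_⟩, ⟨h2r, hR, ?_⟩, ?_⟩
  · intro a ha
    by_contra! h1
    have h2 := Multiset.one_le_count_iff_mem.2 ha
    rw [ht, if_pos (by omega), hs.count_eq_zero h1] at h2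
    omega
  · intro a
    rw [ht, ht]
    have h3 := hs.count_le a
    have h4 := hs.count_le (a + 2)
    rcases lt_trichotomy (a + 1) r with h7 | h7 | h7
    · rw [if_pos (by omega), if_pos h7]; exact h3
    · have := hgt (a + 1 + 2) (by omega)
      rw [if_pos (by omega), if_neg (by omega), show a = r - 1 by omega, hpred]
      rw [show a = r - 1 by omega] at this
      omega
    · rw [if_neg (by omega), if_neg (by omega), show a + 1 + 2 = a + 2 + 1 by ring]
      exact h4
  · rw [ht, if_pos (by omega), hpred]
  · ext a
    rw [count_ins, ht, ht]
    split_ifs with h1 h2 h3 h4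
    · rfl
    · subst h2; omega
    · rw [show a = r + 1 by omega, hsucc]
    · omega
    · rw [Nat.sub_add_cancel (by omega)]

/-! ### The insertion position and the number of new 2's determine each other. -/

theorem card_filter_lt_succ (t : Multiset ℕ) (r : ℕ) :
    (t.filter fun a => a < r + 1).card = (t.filter fun a => a < r).card + t.count r := by
  have : t.filter (fun a => a < r + 1) =
      t.filter (fun a => a < r) + Multiset.replicate (t.count r) r := by
    ext a
    rw [Multiset.count_add, Multiset.count_replicate]
    simp only [Multiset.count_filter]
    split_ifs with h1 h2 h3 h3 h4 <;> first | omega | (subst h3; omega)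
  rw [this, Multiset.card_add, Multiset.card_replicate]

theorem between_succ (t : Multiset ℕ) {r : ℕ} (h : R t 1 < r) :
    between t (r + 1) = between t r + t.count r := by
  rw [between, between, card_filter_lt_succ]
  simp [P, h]

theorem between_add_two {t : Multiset ℕ} (ht : Good t) : between t (R t 1 + 2) = 0 := by
  rw [between_succ t (by omega), ht.count_R_one_add_one, add_zero, between,
    Multiset.card_eq_zero, P, Multiset.filter_filter]
  exact Multiset.filter_eq_nil.2 fun a _ => by omega

theorem between_mono_add (t : Multiset ℕ) {r : ℕ} (k : ℕ) (h : R t 1 < r) :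
    between t r ≤ between t (r + k) ∧ between t (r + k) ≤ between t r + k := by
  induction k with
  | zero => simp
  | succ k ih =>
    rw [← add_assoc, between_succ t (by omega)]
    have := count_le_one (show R t 1 < r + k by omega)
    omega

/-- `between` is 0 at R t 1 + 2 and grows by at most 1 per step. Hence the truncated differences in
`f_ins` are exact and at least 2. -/
theorem Valid.between_lt {t : Multiset ℕ} (ht : Good t) {r : ℕ} (h : Valid t r) :
    between t r + R t 1 + 2 ≤ r := by
  obtain ⟨k, rfl⟩ := Nat.exists_eq_add_of_le h.add_two_le
  have := between_mono_add t k (show R t 1 < R t 1 + 2 by omega)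
  rw [between_add_two ht] at this
  omega

/-- Beyond R t 1 + 2, r - R t 1 - between t r is weakly increasing in r, and it increases on passing
from r' - 1 to r' because r' - 1 is absent. -/
theorem Valid.unique {t : Multiset ℕ} (ht : Good t) {r r' : ℕ} (h : Valid t r) (h' : Valid t r')
    (he : r - R t 1 - between t r = r' - R t 1 - between t r') : r = r' := by
  wlog hlt : r < r' generalizing r r'
  · rcases lt_trichotomy r r' with h1 | h1 | h1
    · exact absurd h1 hlt
    · exact h1
    · exact (this h' h he.symm h1).symm
  exfalso
  obtain ⟨k, rfl⟩ := Nat.exists_eq_add_of_lt hlt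
  have h1 := between_mono_add t k h.lt
  have h2 := between_succ t (show R t 1 < r + k by have := h.lt; omega)
  have h3 := h'.count_pred
  rw [Nat.add_sub_cancel] at h3
  have h4 := h.between_lt ht
  have h5 := h'.between_lt ht
  omega

/-- The same function starts at 2, moves by steps 0 or 1 and is unbounded. At the first r where it
reaches m either r = R t 1 + 2 or the last step was 1, so r - 1 is absent. -/
theorem Good.exists_valid {t : Multiset ℕ} (ht : Good t) {m : ℕ} (hm : 2 ≤ m) :
    ∃ r, Valid t r ∧ r - R t 1 - between t r = m := by
  have hex : ∃ k, m + between t (R t 1 + 2 + k) ≤ 2 + k := by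
    refine ⟨m + t.card, ?_⟩
    have : between t (R t 1 + 2 + (m + t.card)) ≤ t.card :=
      (Multiset.card_le_card (Multiset.filter_le _ _)).trans
        (Multiset.card_le_card (Multiset.filter_le _ _))
    omega
  obtain ⟨k, hk, hmin⟩ : ∃ k, m + between t (R t 1 + 2 + k) ≤ 2 + k ∧
      ∀ l < k, ¬ m + between t (R t 1 + 2 + l) ≤ 2 + l := by
    classical
    exact ⟨Nat.find hex, Nat.find_spec hex, fun l hl => Nat.find_min hex hl⟩
  refine ⟨R t 1 + 2 + k, ⟨by omega, by omega, ?_⟩, ?_⟩ <;> cases k with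
  | zero =>
    have := between_add_two ht
    first
    | exact ht.count_R_one_add_one
    | (simp only [add_zero] at *; omega)
  | succ k =>
    have h1 := hmin k (by omega)
    have h2 := between_succ t (show R t 1 < R t 1 + 2 + k by omega)
    rw [← add_assoc] at hk ⊢
    first
    | (rw [Nat.add_sub_cancel]; omega)
    | omega

/-! ### The image and injectivity of f. -/

/-- The multisets `f s` with `D s = d`. -/
structure IsImageF (d : ℕ) (l : Multiset ℕ) : Prop where
  two_le : ∀ i, 1 ≤ i → i ≤ d → 2 ≤ l.count (2 * i)
  -- The value 2d + 1 is included because partitions in the domain of f have no part 1; therefore h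
  -- moves no part down to 2d.
  count_odd : ∀ a, a ≤ 2 * d + 1 → Odd a → l.count a = 0
  count_zero : l.count 0 = 0
  count_le : ∀ a, 2 * d < a → l.count a ≤ 1

theorem IsImageF.unique {d d' : ℕ} {l : Multiset ℕ} (h : IsImageF d l) (h' : IsImageF d' l) :
    d = d' := by
  wlog hlt : d < d' generalizing d d'
  · rcases lt_trichotomy d d' with h1 | h1 | h1
    · exact absurd h1 hlt
    · exact h1
    · exact (this h' h h1).symm
  have := h'.two_le d' (by omega) le_rfl
  have := h.count_le (2 * d') (by omega)
  omega

theorem count_replicate_add_map (l : Multiset ℕ) (m a : ℕ) :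
    (Multiset.replicate m 2 + l.map fun a => a + 2).count a =
      (if a = 2 then m else 0) + if 2 ≤ a then l.count (a - 2) else 0 := by
  rw [Multiset.count_add, count_map_add, Multiset.count_replicate]
  congr 1
  simp only [eq_comm]

theorem IsImageF.succ {d m : ℕ} {l : Multiset ℕ} (h : IsImageF d l) (hm : 2 ≤ m) :
    IsImageF (d + 1) (Multiset.replicate m 2 + l.map fun a => a + 2) := by
  constructor
  · intro i h1 h2
    rw [count_replicate_add_map, if_pos (by omega : 2 ≤ 2 * i)]
    rcases Nat.eq_or_lt_of_le h1 with rfl | h3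
    · simp; omega
    · have := h.two_le (i - 1) (by omega) (by omega)
      rw [show 2 * i - 2 = 2 * (i - 1) by omega]
      omega
  · intro a h1 h2
    rw [count_replicate_add_map]
    have h3 : 2 ≤ a → l.count (a - 2) = 0 := fun h3 => h.count_odd _ (by omega) (by grind)
    split_ifs <;> grind
  · rw [count_replicate_add_map]; simp
  · intro a h1
    rw [count_replicate_add_map, if_neg (by omega), if_pos (by omega)]
    have := h.count_le (a - 2) (by omega)
    omega

theorem IsImageF.exists_pred {d : ℕ} {l : Multiset ℕ} (h : IsImageF (d + 1) l) :
    ∃ m k, 2 ≤ m ∧ IsImageF d k ∧ l = Multiset.replicate m 2 + k.map fun a => a + 2 := by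
  let k : Multiset ℕ := (l.filter fun a => 2 < a).map fun a => a - 2
  have hk : ∀ a, k.count a = if a = 0 then 0 else l.count (a + 2) := by
    intro a
    rw [count_map_sub _ _ fun x hx => (Multiset.mem_filter.1 hx).2.le, Multiset.count_filter]
    split_ifs <;> omega
  refine ⟨l.count 2, k, h.two_le 1 le_rfl (by omega), ⟨?_, ?_, ?_, ?_⟩, ?_⟩
  · intro i h1 h2
    rw [hk, if_neg (by omega)]
    exact h.two_le (i + 1) (by omega) (by omega)
  · intro a h1 h2
    rw [hk, h.count_odd (a + 2) (by omega) (by grind), ite_self]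
  · rw [hk, if_pos rfl]
  · intro a h1
    rw [hk, if_neg (by omega)]
    exact h.count_le _ (by omega)
  · ext a
    rw [count_replicate_add_map, hk]
    have h0 := h.count_zero
    have h1 := h.count_odd 1 (by omega) odd_one
    rcases (by omega : a = 0 ∨ a = 1 ∨ a = 2 ∨ 2 < a) with rfl | rfl | rfl | h2
    · simpa using h0
    · simpa using h1
    · simp
    · rw [if_neg (by omega), if_pos (by omega), if_neg (by omega), Nat.sub_add_cancel (by omega),
        zero_add]

theorem f_of_D_eq_zero {s : Multiset ℕ} (hs : Good s) (h : D s = 0) : f s = s := by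
  rw [f_eq_sum_range, h]
  simp only [Finset.range_zero, Finset.sum_empty, zero_add, Finset.range_one, Finset.sum_singleton,
    mul_zero, add_zero, Multiset.map_id']
  exact Multiset.filter_eq_self.2 fun a ha => by
    rw [R_one_of_D_eq_zero h]; have := hs.two_le a ha; omega

/-- Induction on the number of repeated parts. -/
theorem Good.induction {p : ∀ s, Good s → Prop} (zero : ∀ s hs, D s = 0 → p s hs)
    (step : ∀ t r (ht : Good t) (hr : Valid t r), p t ht → p (RogersSelberg.ins t r) (ht.ins hr))
    (s : Multiset ℕ) (hs : Good s) : p s hs := by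
  induction hd : D s generalizing s with
  | zero => exact zero s hs hd
  | succ d ih =>
    obtain ⟨t, r, ht, hr, rfl⟩ := hs.exists_ins (by omega)
    rw [D_ins hr] at hd
    exact step t r ht hr (ih t ht (by omega))

theorem Good.isImageF {s : Multiset ℕ} (hs : Good s) : IsImageF (D s) (f s) := by
  induction s, hs using Good.induction with
  | zero s hs h =>
    rw [f_of_D_eq_zero hs h, h]
    have h1 := D_eq_zero_iff.1 h
    exact ⟨by omega, fun a ha _ => hs.count_eq_zero (by omega), hs.count_eq_zero (by omega),
      fun a _ => h1 a⟩
  | step t r ht hr ih =>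
    rw [f_ins hr, D_ins hr]
    exact ih.succ (by have := hr.between_lt ht; omega)

theorem f_injOn : Set.InjOn f {s | Good s} := by
  intro s hs
  induction s, hs using Good.induction with
  | zero s hs h =>
    intro s' hs' he
    have h' : D s' = 0 := by
      have := hs'.isImageF
      rw [← he] at this
      rw [← h]
      exact this.unique hs.isImageF
    rwa [f_of_D_eq_zero hs h, f_of_D_eq_zero hs' h'] at he
  | step t r ht hr ih =>
    intro s' hs' he
    have hd := hs'.isImageF
    rw [← he] at hd
    have hd := hd.unique (ht.ins hr).isImageF
    rw [D_ins hr] at hd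
    obtain ⟨t', r', ht', hr', rfl⟩ := Good.exists_ins hs' (by omega)
    rw [f_ins hr, f_ins hr'] at he
    -- Raising by 2 creates no part 2, as the earlier images have no part 0; so the multiplicity of
    -- 2 recovers m.
    have hc := congrArg (Multiset.count 2) he
    rw [count_replicate_add_map, count_replicate_add_map] at hc
    simp only [if_true, le_refl, Nat.sub_self, ht.isImageF.count_zero, ht'.isImageF.count_zero,
      add_zero] at hc
    rw [hc] at he
    have := ih ht' (Multiset.map_injective (add_left_injective 2) (add_left_cancel he))
    subst this
    rw [hr.unique ht hr' hc]

theorem IsImageF.exists_good {d : ℕ} {l : Multiset ℕ} (h : IsImageF d l) :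
    ∃ s, Good s ∧ D s = d ∧ f s = l := by
  induction d generalizing l with
  | zero =>
    have h1 : ∀ a, l.count a ≤ 1 := fun a => by
      rcases Nat.eq_zero_or_pos a with rfl | ha
      · rw [h.count_zero]; omega
      · exact h.count_le a (by omega)
    have hl : Good l := by
      refine ⟨fun a ha => ?_, fun a => by have := h1 a; have := h1 (a + 1); omega⟩
      by_contra! h2
      have := Multiset.one_le_count_iff_mem.2 ha
      have := h.count_zero
      have := h.count_odd 1 (by omega) odd_one
      interval_cases a <;> omega
    have hD := D_eq_zero_iff.2 h1
    exact ⟨l, hl, hD, f_of_D_eq_zero hl hD⟩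
  | succ d ih =>
    obtain ⟨m, k, hm, hk, rfl⟩ := h.exists_pred
    obtain ⟨t, ht, hd, rfl⟩ := ih hk
    obtain ⟨r, hr, rfl⟩ := ht.exists_valid hm
    exact ⟨ins t r, ht.ins hr, by rw [D_ins hr, hd], f_ins hr⟩

/-! ### Lengths and sums under f. -/

theorem filter_lt_add_filter_le (t : Multiset ℕ) (r : ℕ) :
    t.filter (fun a => a < r) + t.filter (fun a => r ≤ a) = t := by
  simpa only [not_lt] using Multiset.filter_add_not (fun a => a < r) t

theorem card_ins (t : Multiset ℕ) (r : ℕ) : (ins t r).card = t.card + 2 := by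
  conv_rhs => rw [← filter_lt_add_filter_le t r]
  simp only [ins, Multiset.card_add, Multiset.card_map, Multiset.card_replicate]
  omega

theorem sum_map_add (t : Multiset ℕ) (c : ℕ) :
    (t.map fun a => a + c).sum = t.sum + c * t.card := by
  rw [Multiset.sum_map_add, Multiset.map_id', Multiset.map_const', Multiset.sum_replicate,
    smul_eq_mul, mul_comm]

theorem sum_ins (t : Multiset ℕ) (r : ℕ) :
    (ins t r).sum = t.sum + 2 * r + 2 * (t.filter fun a => r ≤ a).card := by
  have := congrArg Multiset.sum (filter_lt_add_filter_le t r)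
  rw [Multiset.sum_add] at this
  rw [ins, Multiset.sum_add, Multiset.sum_add, sum_map_add, Multiset.sum_replicate, smul_eq_mul]
  omega

theorem card_P {t : Multiset ℕ} {r : ℕ} (hr : Valid t r) :
    (P t).card = between t r + (P (ins t r)).card := by
  rw [P_ins hr, Multiset.card_map, between, ← filter_lt_add_filter_le (P t) r, Multiset.card_add,
    filter_lt_add_filter_le]
  congr 2
  rw [P, Multiset.filter_filter]
  have := hr.lt
  exact Multiset.filter_congr fun a _ => by omega

/-- Raising every part of f t by 2 costs twice this length, which is what the induction for
`Good.sum_f` requires. -/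
theorem Good.card_f {s : Multiset ℕ} (hs : Good s) : (f s).card = R s 1 + (P s).card := by
  induction s, hs using Good.induction with
  | zero s hs h =>
    have h1 : P s = s := Multiset.filter_eq_self.2 fun a ha => by
      rw [R_one_of_D_eq_zero h]; have := hs.two_le a ha; omega
    rw [f_of_D_eq_zero hs h, h1, R_one_of_D_eq_zero h, zero_add]
  | step t r ht hr ih =>
    rw [f_ins hr, R_ins_one hr, Multiset.card_add, Multiset.card_map, Multiset.card_replicate, ih,
      card_P hr]
    have := hr.between_lt ht
    omega

theorem Good.sum_f {s : Multiset ℕ} (hs : Good s) : (f s).sum = s.sum := by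
  induction s, hs using Good.induction with
  | zero s hs h => rw [f_of_D_eq_zero hs h]
  | step t r ht hr ih =>
    rw [f_ins hr, Multiset.sum_add, sum_map_add, ih, ht.card_f, Multiset.sum_replicate, smul_eq_mul,
      sum_ins, card_P hr, P_ins hr, Multiset.card_map]
    have := hr.between_lt ht
    omega

/-- The left side is the number of units that h removes from f s, so h undoes the growth caused by
g. -/
theorem Good.card_filter_f {s : Multiset ℕ} (hs : Good s) :
    ((f s).filter fun a => 2 * D s < a).card + 2 * D s = s.card := by
  induction s, hs using Good.induction with
  | zero s hs h =>
    rw [f_of_D_eq_zero hs h, h]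
    rw [Multiset.filter_eq_self.2 fun a ha => by have := hs.two_le a ha; omega]
    rfl
  | step t r ht hr ih =>
    rw [card_ins, ← ih, D_ins hr, f_ins hr, Multiset.filter_add, Multiset.filter_map,
      Multiset.filter_eq_nil.2 fun a ha => by rw [Multiset.eq_of_mem_replicate ha]; omega,
      Multiset.zero_add, Multiset.card_map]
    simp only [Function.comp_def]
    have : ∀ a, 2 * (D t + 1) < a + 2 ↔ 2 * D t < a := fun a => by omega
    simp only [this]
    omega

/-! ### The map h and the partitions in 𝒜₃. -/

theorem IsImageF.R_one {d : ℕ} {l : Multiset ℕ} (h : IsImageF d l) : R l 1 = 2 * d := by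
  apply le_antisymm
  · refine Finset.sup_le fun a ha => ?_
    rw [mem_repeated] at ha
    by_contra! h1
    have := h.count_le a h1
    omega
  · rcases Nat.eq_zero_or_pos d with rfl | hd
    · simp
    · exact le_R_one (h.two_le d hd le_rfl)

theorem count_evenPairs (d a : ℕ) :
    (evenPairs d).count a = if 1 ≤ a ∧ a ≤ 2 * d ∧ Even a then 2 else 0 := by
  rw [evenPairs, Multiset.count_sum']
  simp only [Multiset.count_replicate]
  split_ifs with h
  · obtain ⟨b, rfl⟩ := h.2.2
    rw [Finset.sum_eq_single b, if_pos (by ring)]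
    · intro c _ hc; rw [if_neg (by omega)]
    · intro hb; rw [Finset.mem_Icc] at hb; omega
  · refine Finset.sum_eq_zero fun b hb => if_neg ?_
    rintro rfl
    rw [Finset.mem_Icc] at hb
    exact h ⟨by omega, by omega, even_two_mul b⟩

theorem card_evenPairs (d : ℕ) : (evenPairs d).card = 2 * d := by
  rw [evenPairs, Multiset.card_sum]
  simp [mul_comm]

theorem one_le_of_mem_evenPairs {d a : ℕ} (ha : a ∈ evenPairs d) : 1 ≤ a := by
  rw [← Multiset.one_le_count_iff_mem, count_evenPairs] at ha
  split_ifs at ha <;> omega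

theorem sum_map_sub_one (s : Multiset ℕ) (hs : ∀ a ∈ s, 1 ≤ a) :
    (s.map fun a => a - 1).sum + s.card = s.sum := by
  induction s using Multiset.induction with
  | empty => rfl
  | cons a s ih =>
    have := ih fun b hb => hs b (Multiset.mem_cons_of_mem hb)
    have := hs a (Multiset.mem_cons_self a s)
    rw [Multiset.map_cons, Multiset.sum_cons, Multiset.sum_cons, Multiset.card_cons]
    omega

theorem IsImageF.P_eq {d : ℕ} {l : Multiset ℕ} (h : IsImageF d l) :
    P l = l.filter fun a => 2 * d < a := by
  rw [P, h.R_one]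

theorem IsImageF.evenPairs_le {d : ℕ} {l : Multiset ℕ} (h : IsImageF d l) :
    evenPairs d ≤ l - P l := by
  rw [Multiset.le_iff_count]
  intro a
  rw [Multiset.count_sub, count_evenPairs, h.P_eq, Multiset.count_filter]
  split_ifs with h1 h2
  · omega
  · obtain ⟨b, rfl⟩ := h1.2.2
    have := h.two_le b (by omega) (by omega)
    rw [two_mul] at this
    omega
  · omega
  · omega

theorem IsImageF.sum_h {d : ℕ} {l : Multiset ℕ} (h : IsImageF d l) :
    (RogersSelberg.h l).sum + (l.filter fun a => 2 * d < a).card + 2 * d = l.sum := by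
  have h1 : l = P l + (evenPairs d + (l - P l - evenPairs d)) := by
    rw [add_tsub_cancel_of_le h.evenPairs_le]
    exact (add_tsub_cancel_of_le (Multiset.filter_le _ _)).symm
  have h2 := congrArg Multiset.sum h1
  rw [RogersSelberg.h, h.R_one, Nat.mul_div_cancel_left _ (by omega), ← h.P_eq]
  rw [Multiset.sum_add, Multiset.sum_add] at h2 ⊢
  have h3 := sum_map_sub_one (P l) fun a ha => by
    have := (Multiset.mem_filter.1 ha).2; omega
  have h4 := sum_map_sub_one (evenPairs d) fun a => one_le_of_mem_evenPairs
  rw [card_evenPairs] at h4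
  omega

/-- The odd parts up to 2d come only from the lowered even pairs, and the parts above 2d only from
`P l`. These multiplicities make h invertible once d is known. -/
theorem IsImageF.count_h {d : ℕ} {l : Multiset ℕ} (h : IsImageF d l) (a : ℕ) :
    (RogersSelberg.h l).count a = if 2 * d < a then l.count (a + 1) else
      if Odd a then 2 else if a = 0 then 0 else l.count a - 2 := by
  rw [RogersSelberg.h, h.R_one, Nat.mul_div_cancel_left _ (by omega), Multiset.count_add,
    Multiset.count_add, count_map_sub _ 1 fun x hx => by
      have := (Multiset.mem_filter.1 hx).2; omega,
    count_map_sub _ 1 fun x => one_le_of_mem_evenPairs, Multiset.count_sub, Multiset.count_sub,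
    count_evenPairs, count_evenPairs, h.P_eq, Multiset.count_filter, Multiset.count_filter]
  have h1 := h.count_odd a
  have h2 := h.count_odd (a + 1)
  have h3 := h.count_zero
  have h4 : a = 0 → l.count a = 0 := by rintro rfl; exact h3
  rcases Nat.even_or_odd a with he | ho
  · have hno : ¬ Odd a := Nat.not_odd_iff_even.2 he
    have hne : ¬ Even (a + 1) := by grind
    have ho' : Odd (a + 1) := by grind
    simp only [he, hno, hne, and_true, and_false, if_false]
    split_ifs <;> first | omega | (have := h2 (by omega) ho'; omega)
  · have hne : ¬ Even a := Nat.not_even_iff_odd.2 ho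
    have he : Even (a + 1) := by grind
    simp only [he, ho, hne, and_true, and_false, if_true, if_false]
    split_ifs <;> first | omega | (have := h1 (by omega) ho; omega) | grind

/-- The condition `IsA3` for partitions, with the value of `j` given. -/
structure IsA3At (d : ℕ) (m : Multiset ℕ) : Prop where
  count_odd : ∀ a, a ≤ 2 * d → Odd a → m.count a = 2
  count_zero : m.count 0 = 0
  count_le : ∀ a, 2 * d < a → m.count a ≤ 1

theorem IsA3At.unique {d d' : ℕ} {m : Multiset ℕ} (h : IsA3At d m) (h' : IsA3At d' m) :
    d = d' := by
  wlog hlt : d < d' generalizing d d'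
  · rcases lt_trichotomy d d' with h1 | h1 | h1
    · exact absurd h1 hlt
    · exact h1
    · exact (this h' h h1).symm
  have := h'.count_odd (2 * d' - 1) (by omega) (by grind)
  have := h.count_le (2 * d' - 1) (by omega)
  omega

/-- The value d = 0 absorbs the case without repeated parts; otherwise d is j. -/
theorem isA3_and_pos_iff (m : Multiset ℕ) :
    (IsA3 m ∧ ∀ a ∈ m, 0 < a) ↔ ∃ d, IsA3At d m := by
  have hpos : (∀ a ∈ m, 0 < a) ↔ m.count 0 = 0 := by
    rw [Multiset.count_eq_zero]
    exact ⟨fun h h0 => lt_irrefl _ (h 0 h0), fun h a ha => Nat.pos_of_ne_zero fun h0 => h (h0 ▸ ha)⟩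
  rw [hpos]
  constructor
  · rintro ⟨h | ⟨j, hj, h1, h2, h3⟩, h0⟩
    · exact ⟨0, fun a ha ho => by grind, h0, fun a _ => Multiset.nodup_iff_count_le_one.1 h a⟩
    · exact ⟨j, fun a ha ho => h2 a ho (by grind), h0, h3⟩
  · rintro ⟨d, h1, h0, h2⟩
    refine ⟨?_, h0⟩
    rcases Nat.eq_zero_or_pos d with rfl | hd
    · refine Or.inl (Multiset.nodup_iff_count_le_one.2 fun a => ?_)
      rcases Nat.eq_zero_or_pos a with rfl | ha
      · omega
      · exact h2 a (by omega)
    · refine Or.inr ⟨d, hd, ⟨⟨by grind, ?_⟩, ?_⟩, fun a ho ha => h1 a (by omega) ho, h2⟩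
      · rw [h1 (2 * d - 1) (by omega) (by grind)]
      · rintro a ⟨ho, ha⟩
        by_contra! h3
        have := h2 a (by grind)
        omega

theorem IsImageF.isA3At {d : ℕ} {l : Multiset ℕ} (h : IsImageF d l) :
    IsA3At d (RogersSelberg.h l) := by
  refine ⟨fun a ha ho => ?_, ?_, fun a ha => ?_⟩
  · rw [h.count_h, if_neg (by omega), if_pos ho]
  · rw [h.count_h]; simp
  · rw [h.count_h, if_pos ha]
    exact h.count_le _ (by omega)

theorem IsImageF.h_inj {d d' : ℕ} {l l' : Multiset ℕ} (hl : IsImageF d l) (hl' : IsImageF d' l')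
    (he : h l = h l') : l = l' := by
  obtain rfl : d = d' := hl.isA3At.unique (by rw [he]; exact hl'.isA3At)
  have hc : ∀ a, (h l).count a = (h l').count a := fun a => by rw [he]
  simp only [hl.count_h, hl'.count_h] at hc
  ext a
  rcases Nat.lt_or_ge (2 * d + 1) a with h1 | h1
  · have := hc (a - 1)
    rw [if_pos (by omega), if_pos (by omega), Nat.sub_add_cancel (by omega)] at this
    exact this
  · rcases Nat.even_or_odd a with h2 | h2
    · rcases Nat.eq_zero_or_pos a with rfl | h3
      · rw [hl.count_zero, hl'.count_zero]
      · have := hc a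
        have hle : ¬ 2 * d < a := by grind
        rw [if_neg hle, if_neg hle, if_neg (Nat.not_odd_iff_even.2 h2),
          if_neg (Nat.not_odd_iff_even.2 h2), if_neg (by omega), if_neg (by omega)] at this
        obtain ⟨b, rfl⟩ := h2
        have h4 := hl.two_le b (by omega) (by omega)
        have h5 := hl'.two_le b (by omega) (by omega)
        rw [two_mul] at h4 h5
        omega
    · rw [hl.count_odd a h1 h2, hl'.count_odd a h1 h2]

theorem IsA3At.exists_isImageF {d : ℕ} {m : Multiset ℕ} (hm : IsA3At d m) :
    ∃ l, IsImageF d l ∧ h l = m := by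
  -- The inverse of h: the doubled odd parts below 2d become pairs of even parts, and all parts
  -- above 2d are raised by 1.
  let l : Multiset ℕ := m.filter (fun a => a ≤ 2 * d ∧ Even a) + evenPairs d +
    (m.filter fun a => 2 * d < a).map fun a => a + 1
  have hl : ∀ a, l.count a = if 2 * d + 1 < a then m.count (a - 1) else
      if Odd a ∨ a = 0 then 0 else m.count a + 2 := by
    intro a
    rw [Multiset.count_add, Multiset.count_add, count_map_add, count_evenPairs]
    simp only [Multiset.count_filter]
    have h0 : a = 0 → m.count a = 0 := by rintro rfl; exact hm.count_zero
    rcases Nat.even_or_odd a with he | ho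
    · have hno : ¬ Odd a := Nat.not_odd_iff_even.2 he
      simp only [he, hno, and_true, false_or]
      split_ifs <;> first | omega | grind
    · have hne : ¬ Even a := Nat.not_even_iff_odd.2 ho
      simp only [ho, hne, and_false, true_or, if_true, if_false]
      split_ifs <;> omega
  have hI : IsImageF d l := by
    refine ⟨fun i h1 h2 => ?_, fun a h1 h2 => ?_, ?_, fun a h1 => ?_⟩
    · rw [hl, if_neg (by omega), if_neg (by grind)]
      omega
    · rw [hl, if_neg (by omega), if_pos (Or.inl h2)]
    · rw [hl, if_neg (by omega), if_pos (Or.inr rfl)]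
    · rw [hl]
      rcases Nat.lt_or_ge (2 * d + 1) a with h2 | h2
      · rw [if_pos h2]; exact hm.count_le _ (by omega)
      · rw [if_neg (by omega), if_pos (by grind)]; omega
  refine ⟨l, hI, ?_⟩
  ext a
  rw [hI.count_h, hl, hl]
  split_ifs with h1 h2 h3 h3 h4 h5 h6
  all_goals first
    | omega
    | rfl
    | (rw [hm.count_odd a (by omega) (by assumption)])
    | (subst_vars; rw [hm.count_zero])
    | grind

/-! ### The map g, and assembly of the bijection and the count. -/

theorem count_g (s : Multiset ℕ) (a : ℕ) :
    (g s).count a = if 1 ≤ a then s.count (a - 1) else 0 := count_map_add s 1 a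

theorem good_g {s : Multiset ℕ} (hs : IsGordon 3 3 s) (hpos : ∀ a ∈ s, 0 < a) : Good (g s) := by
  constructor
  · intro a ha
    obtain ⟨b, hb, rfl⟩ := Multiset.mem_map.1 ha
    have := hpos b hb
    omega
  · intro a
    rw [count_g, count_g, if_pos (by omega : 1 ≤ a + 1), Nat.add_sub_cancel]
    have h0 : s.count 0 = 0 := Multiset.count_eq_zero_of_notMem fun h => lt_irrefl _ (hpos 0 h)
    rcases (by omega : a = 0 ∨ a = 1 ∨ 2 ≤ a) with rfl | rfl | h1
    · simp [h0]
    · have : s.count 1 < 3 := hs.1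
      rw [if_pos le_rfl, Nat.sub_self, h0]
      omega
    · have := hs.2 (a - 1) (by omega)
      rw [Nat.sub_add_cancel (by omega)] at this
      rw [if_pos (by omega)]
      omega

theorem Good.exists_g {t : Multiset ℕ} (ht : Good t) :
    ∃ s, IsGordon 3 3 s ∧ (∀ a ∈ s, 0 < a) ∧ g s = t := by
  have hc : ∀ a, (t.map fun a => a - 1).count a = t.count (a + 1) :=
    count_map_sub t 1 fun x hx => by have := ht.two_le x hx; omega
  refine ⟨t.map fun a => a - 1, ⟨?_, fun j _ => ?_⟩, ?_, ?_⟩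
  · rw [hc]; have := ht.count_le 1; omega
  · rw [hc, hc]; have := ht.count_le (j + 1); omega
  · intro a ha
    obtain ⟨b, hb, rfl⟩ := Multiset.mem_map.1 ha
    have := ht.two_le b hb
    omega
  · ext a
    rw [count_g, hc]
    split_ifs with h1
    · rw [Nat.sub_add_cancel h1]
    · exact (ht.count_eq_zero (by omega)).symm

theorem sum_h_f_g {s : Multiset ℕ} (hs : Good (g s)) : (h (f (g s))).sum = s.sum := by
  have h1 := hs.isImageF.sum_h
  have h2 := hs.card_filter_f
  have h3 : (g s).sum = s.sum + 1 * s.card := sum_map_add s 1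
  have h4 : (g s).card = s.card := Multiset.card_map _ _
  have h5 := hs.sum_f
  omega

theorem bijOn_h_f_g (n : ℕ) : Set.BijOn (h ∘ f ∘ g)
    {s : Multiset ℕ | ∃ p : n.Partition, p.parts = s ∧ IsGordon 3 3 s}
    {s : Multiset ℕ | ∃ p : n.Partition, p.parts = s ∧ IsA3 s} := by
  simp only [exists_and_right, exists_partition_iff]
  refine ⟨?_, ?_, ?_⟩
  · rintro s ⟨⟨hsum, hpos⟩, hs⟩
    have hg := good_g hs hpos
    obtain ⟨h1, h2⟩ := (isA3_and_pos_iff _).2 ⟨_, hg.isImageF.isA3At⟩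
    exact ⟨⟨(sum_h_f_g hg).trans hsum, h2⟩, h1⟩
  · rintro s ⟨⟨_, hpos⟩, hs⟩ s' ⟨⟨_, hpos'⟩, hs'⟩ he
    have hg := good_g hs hpos
    have hg' := good_g hs' hpos'
    exact Multiset.map_injective (add_left_injective 1)
      (f_injOn hg hg' (hg.isImageF.h_inj hg'.isImageF he))
  · rintro m ⟨⟨hsum, hpos⟩, hm⟩
    obtain ⟨d, hd⟩ := (isA3_and_pos_iff m).1 ⟨hm, hpos⟩
    obtain ⟨l, hl, rfl⟩ := hd.exists_isImageF
    obtain ⟨t, ht, -, rfl⟩ := hl.exists_good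
    obtain ⟨s, hs, hspos, rfl⟩ := ht.exists_g
    exact ⟨s, ⟨⟨(sum_h_f_g ht).symm.trans hsum, hspos⟩, hs⟩, rfl⟩

theorem A3_eq_ncard (n : ℕ) :
    A3 n = {s : Multiset ℕ | ∃ p : n.Partition, p.parts = s ∧ IsA3 s}.ncard := by
  have : {s : Multiset ℕ | ∃ p : n.Partition, p.parts = s ∧ IsA3 s} =
      Nat.Partition.parts '' {p : n.Partition | IsA3 p.parts} := by
    ext s
    constructor
    · rintro ⟨p, rfl, h⟩; exact ⟨p, h, rfl⟩
    · rintro ⟨p, h, rfl⟩; exact ⟨p, rfl, h⟩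
  rw [this, Set.ncard_image_of_injective _ fun p q h => Nat.Partition.ext h]
  rfl

theorem gordonSet_three_zero (n : ℕ) : gordonSet 3 0 n =
    {s : Multiset ℕ | ∃ p : n.Partition, p.parts = s ∧ IsGordon 3 3 s} := by
  simp only [exists_and_right, exists_partition_iff]
  ext s
  exact and_assoc.symm

end RogersSelberg

theorem mainTheorem6 (n : ℕ) :
    RogersSelberg.A3 n = RogersSelberg.C 3 3 n ∧
      Set.BijOn (RogersSelberg.h ∘ RogersSelberg.f ∘ RogersSelberg.g)
        {s : Multiset ℕ | ∃ p : n.Partition, p.parts = s ∧ RogersSelberg.IsGordon 3 3 s}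
        {s : Multiset ℕ | ∃ p : n.Partition, p.parts = s ∧ RogersSelberg.IsA3 s} := by
  refine ⟨?_, RogersSelberg.bijOn_h_f_g n⟩
  rw [RogersSelberg.A3_eq_ncard, ← (RogersSelberg.bijOn_h_f_g n).image_eq,
    (RogersSelberg.bijOn_h_f_g n).injOn.ncard_image, ← RogersSelberg.gordonSet_three_zero,
    RogersSelberg.ncard_gordonSet]
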